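/- Let $N\ge 2$ and, for $\gamma\in\mathbb R$, let $P_\gamma=\{x=(x',x_N)\in\mathbb R^{N-1}\times\mathbb R : x_N>\gamma|x'|^2\}$. Say that a domain (a nonempty connected open set) $\Omega\subset\mathbb R^N$ is hyperbolic (at the origin) if $0\in\partial\Omega$ and $\Omega\subset P_\gamma$ for some $\gamma<0$. (i) For every hyperbolic domain $\Omega\subset\mathbb R^N$ and every $\varepsilon>0$ there is a constant $C=C(\Omega,\varepsilon)>0$ such that, for all $v\in H_0^1(\Omega)$, the function $v^2/|x|^2$ is integrable on $\Omega$ and $$C\int_\Omega v^2\,dx+\int_\Omega|\nabla v|^2\,dx\;\ge\;\Big(\frac{N^2}{4}-\varepsilon\Big)\int_\Omega\frac{v^2}{|x|^2}\,dx .$$ (ii) The $L^2$ term on the left-hand side cannot be dropped in general: there is a bounded hyperbolic domain $\Omega\subset\mathbb R^N$ with $C^\infty$ boundary, which moreover contains $P_{\gamma'}\cap B_r(0)$ for some $\gamma'<0$ and $r>0$, and there is $\varepsilon_0>0$ such that for every $\varepsilon\in(0,\varepsilon_0)$ there is $v\in H_0^1(\Omega)$ with $$\int_\Omega|\nabla v|^2\,dx<\Big(\frac{N^2}{4}-\varepsilon\Big)\int_\Omega\frac{v^2}{|x|^2}\,dx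 .$$ -/

import Mathlib

open MeasureTheory Filter Set
open scoped Topology ContDiff

namespace HyperbolicHardy

/-- `ℝ^N` with `N = n + 1` and its Euclidean norm; a point is `x = (x', x_N)` with
`x' = (x 0, …, x (n - 1))` and `x_N = x (Fin.last n)`. -/
abbrev E (n : ℕ) : Type := EuclideanSpace ℝ (Fin (n + 1))

/-- The paraboloid `P_γ = {x = (x', x_N) | x_N > γ |x'|²}`. -/
def paraboloid (n : ℕ) (γ : ℝ) : Set (E n) :=
  {x | γ * ∑ i : Fin n, x i.castSucc ^ 2 < x (Fin.last n)}

/-- A domain with the origin on its boundary that lies in some `P_γ` with `γ < 0`. -/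
structure IsHyperbolicDomain {n : ℕ} (Ω : Set (E n)) : Prop where
  isOpen : IsOpen Ω
  isConnected : IsConnected Ω
  zero_mem_frontier : (0 : E n) ∈ frontier Ω
  subset_paraboloid : ∃ γ : ℝ, γ < 0 ∧ Ω ⊆ paraboloid n γ

/-- Near the origin `Ω` contains some `P_γ` with `γ < 0`: the boundary is
really curved away from `Ω` there (all principal curvatures at the origin are negative). -/
def ContainsParaboloidNearZero {n : ℕ} (Ω : Set (E n)) : Prop :=
  ∃ γ : ℝ, γ < 0 ∧ ∃ r : ℝ, 0 < r ∧ paraboloid n γ ∩ Metric.ball 0 r ⊆ Ω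

/-- `Ω` has a `C^∞` boundary: near each of its boundary points it is the positivity set of a
smooth function whose derivative does not vanish at that point. -/
def HasSmoothBoundary {n : ℕ} (Ω : Set (E n)) : Prop :=
  ∀ p ∈ frontier Ω, ∃ U : Set (E n), IsOpen U ∧ p ∈ U ∧ ∃ F : E n → ℝ,
    ContDiffOn ℝ ∞ F U ∧ fderiv ℝ F p ≠ 0 ∧ Ω ∩ U = {x ∈ U | 0 < F x}

/-- `φ ∈ C_c^∞(Ω)`. -/
def IsTestFunction {n : ℕ} (Ω : Set (E n)) (φ : E n → ℝ) : Prop :=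
  ContDiff ℝ ∞ φ ∧ HasCompactSupport φ ∧ tsupport φ ⊆ Ω

/-- `G` is the weak (distributional) gradient of `v` in `Ω`. -/
def HasWeakGradient {n : ℕ} (Ω : Set (E n)) (v : E n → ℝ) (G : E n → E n) : Prop :=
  ∀ φ : E n → ℝ, IsTestFunction Ω φ → ∀ i : Fin (n + 1),
    ∫ x in Ω, v x * fderiv ℝ φ x (EuclideanSpace.single i 1) = - ∫ x in Ω, G x i * φ x

/-- `v ∈ H¹(Ω)` with weak gradient `G`. -/
def MemH1 {n : ℕ} (Ω : Set (E n)) (v : E n → ℝ) (G : E n → E n) : Prop :=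
  MemLp v 2 (volume.restrict Ω) ∧ MemLp G 2 (volume.restrict Ω) ∧ HasWeakGradient Ω v G

/-- `v ∈ H¹₀(Ω)`, the closure of `C_c^∞(Ω)` in `H¹(Ω)`, with weak gradient `G`. -/
def MemH10 {n : ℕ} (Ω : Set (E n)) (v : E n → ℝ) (G : E n → E n) : Prop :=
  MemH1 Ω v G ∧ ∃ φ : ℕ → E n → ℝ, (∀ k, IsTestFunction Ω (φ k)) ∧
    Tendsto (fun k => eLpNorm (fun x => φ k x - v x) 2 (volume.restrict Ω)) atTop (𝓝 0) ∧
    Tendsto (fun k => eLpNorm (fun x => gradient (φ k) x - G x) 2 (volume.restrict Ω))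
      atTop (𝓝 0)

end HyperbolicHardy

namespace HyperbolicHardy

variable {n : ℕ}

/-! Part (i) rests on a supersolution. Completing the square in |∇u + uX|² and integrating by parts
gives ∫|∇u|² ≥ ∫(div X - |X|²)u² for any C¹ field X near the support of u
(`integral_mul_sq_le_of_field`). Put h = x_N + k|x|² with k = -γ, so that Ω ⊂ P_γ ⊂ {h > 0}, and
take X = -∇ log w with w = h e^{-2√h} |x|^{-N/2}; then div X - |X|² = -Δw/w. For a half-space, x_N
|x|^{-N/2} gives exactly N²/(4|x|²). The curved boundary adds an error of order 1/h; the factor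
e^{-2√h} yields a positive term of order h^{-3/2} that absorbs it, at a cost of N√h/|x|², which is
at most ε/|x|² near 0 (`weight_le`, `hardy_near_zero`). A cutoff moves everything away from 0 into
the L² term, and Fatou's lemma passes from test functions to H¹₀.

Part (ii) uses that N²/4 is too large for the complement of the ray x' = 0, x_N ≤ 0. There W = (x_N
+ |x|) |x|^{-N/2} P(log|x|²) strictly satisfies ΔW + N²W/(4|x|²) > 0 on {W > 0}, for a suitable bump
P (`subsolLap_add_pos`). Testing with W, truncated where W is small, makes the Hardy energy with
constant N²/4 negative (`exists_energy_neg`). The truncated function has compact support away from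
the ray, so it fits in a strongly sheared large ball (`exists_subset_shearedBall`), which is a
smooth bounded hyperbolic domain. -/

/-- The unit vector in the direction of the last coordinate. -/
noncomputable abbrev lastVec (n : ℕ) : E n := EuclideanSpace.single (Fin.last n) 1

/-! ### Coordinates, integration by parts, and Hardy inequalities from vector fields -/

lemma contDiff_coord (i : Fin (n + 1)) {k : WithTop ℕ∞} : ContDiff ℝ k (fun x : E n => x i) :=
  (EuclideanSpace.proj i : E n →L[ℝ] ℝ).contDiff

lemma hasFDerivAt_coord (i : Fin (n + 1)) (x : E n) :
    HasFDerivAt (fun x : E n => x i) (EuclideanSpace.proj i : E n →L[ℝ] ℝ) x :=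
  (EuclideanSpace.proj i : E n →L[ℝ] ℝ).hasFDerivAt

lemma sum_coord_smul_single (x : E n) :
    ∑ i, x i • (EuclideanSpace.single i (1 : ℝ) : E n) = x := by
  ext j
  simp [Finset.sum_apply, Pi.single_apply]

lemma hasFDerivAt_norm_sq' (x : E n) :
    HasFDerivAt (fun x : E n => ‖x‖ ^ 2) (2 • (innerSL ℝ x)) x :=
  (hasStrictFDerivAt_norm_sq x).hasFDerivAt

lemma integral_fderiv_apply_eq_zero {f : E n → ℝ} (hf : ContDiff ℝ 1 f)
    (hc : HasCompactSupport f) (v : E n) : ∫ x, fderiv ℝ f x v = 0 := by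
  have hd : Integrable (fun x => fderiv ℝ f x v) :=
    ((hf.continuous_fderiv one_ne_zero).clm_apply continuous_const).integrable_of_hasCompactSupport
      (hc.fderiv_apply ℝ v)
  have := integral_mul_fderiv_eq_neg_fderiv_mul_of_integrable (μ := (volume : Measure (E n)))
    (f := fun _ : E n => (1 : ℝ)) (g := f) (v := v) (by simp) (by simpa using hd)
    (by simpa using hf.continuous.integrable_of_hasCompactSupport hc) (by fun_prop)
    (fun x _ => (hf.differentiable one_ne_zero).differentiableAt)
  simpa using this

/-- This allows coefficients that are singular at the origin or on the hypersurface: multiplication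
by a function supported away from these sets gives a globally regular function. -/
lemma contDiff_mul_of_tsupport_subset {k : WithTop ℕ∞} {U : Set (E n)} (hU : IsOpen U)
    {ψ a : E n → ℝ} (hψ : ContDiff ℝ k ψ) (hs : tsupport ψ ⊆ U) (ha : ContDiffOn ℝ k a U) :
    ContDiff ℝ k (fun x => ψ x * a x) := by
  rw [contDiff_iff_contDiffAt]
  intro x
  by_cases hx : x ∈ tsupport ψ
  · exact hψ.contDiffAt.mul (ha.contDiffAt (hU.mem_nhds (hs hx)))
  · have : (fun x => ψ x * a x) =ᶠ[𝓝 x] fun _ => 0 := by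
      filter_upwards [notMem_tsupport_iff_eventuallyEq.1 hx] with y hy
      simp [hy]
    exact contDiffAt_const.congr_of_eventuallyEq this

lemma continuous_mul_of_tsupport_subset {U : Set (E n)} (hU : IsOpen U)
    {ψ a : E n → ℝ} (hψ : Continuous ψ) (hs : tsupport ψ ⊆ U) (ha : ContinuousOn a U) :
    Continuous (fun x => ψ x * a x) := by
  rw [← contDiff_zero (𝕜 := ℝ)] at hψ ⊢
  exact contDiff_mul_of_tsupport_subset hU hψ hs (contDiffOn_zero.2 ha)

lemma integral_fderiv_apply_self_add {f : E n → ℝ} (hf : ContDiff ℝ 1 f)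
    (hc : HasCompactSupport f) : ∫ x, (fderiv ℝ f x x + ((n : ℝ) + 1) * f x) = 0 := by
  have h0 : ∀ i : Fin (n + 1), ContDiff ℝ 1 (fun x : E n => f x * x i) := fun i =>
    hf.mul (contDiff_coord i)
  have h1 : ∀ i : Fin (n + 1), HasCompactSupport (fun x : E n => f x * x i) := fun i => hc.mul_right
  have h2 : ∀ x : E n, fderiv ℝ f x x + ((n : ℝ) + 1) * f x =
      ∑ i : Fin (n + 1), fderiv ℝ (fun x : E n => f x * x i) x (EuclideanSpace.single i 1) := by
    intro x
    have h3 : ∀ i : Fin (n + 1), fderiv ℝ (fun x : E n => f x * x i) x (EuclideanSpace.single i 1)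
        = f x + x i * fderiv ℝ f x (EuclideanSpace.single i 1) := by
      intro i
      rw [fderiv_fun_mul (hf.differentiable one_ne_zero x) (hasFDerivAt_coord i x).differentiableAt,
        (hasFDerivAt_coord i x).fderiv]
      simp
    simp_rw [h3, Finset.sum_add_distrib]
    have h4 : fderiv ℝ f x x = ∑ i, x i * fderiv ℝ f x (EuclideanSpace.single i 1) := by
      conv_lhs => rw [← sum_coord_smul_single x, map_sum]
      simp [sum_coord_smul_single]
    rw [h4]
    simp
    ring
  simp_rw [h2]
  rw [integral_finsetSum]
  · simp [integral_fderiv_apply_eq_zero (h0 _) (h1 _)]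
  · intro i _
    exact (((h0 i).continuous_fderiv one_ne_zero).clm_apply
      continuous_const).integrable_of_hasCompactSupport ((h1 i).fderiv_apply ℝ _)

lemma fderiv_mul_of_tsupport_subset {U : Set (E n)} (hU : IsOpen U)
    {ψ a : E n → ℝ} (hψ : ContDiff ℝ 1 ψ) (hs : tsupport ψ ⊆ U) (ha : ContDiffOn ℝ 1 a U)
    (x v : E n) :
    fderiv ℝ (fun x => ψ x * a x) x v = ψ x * fderiv ℝ a x v + a x * fderiv ℝ ψ x v := by
  by_cases hx : x ∈ tsupport ψ
  · have hb := (ha.contDiffAt (hU.mem_nhds (hs hx))).differentiableAt one_ne_zero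
    rw [fderiv_fun_mul (hψ.differentiable one_ne_zero x) hb]
    simp
  · have h1 := notMem_tsupport_iff_eventuallyEq.1 hx
    have h2 : (fun x => ψ x * a x) =ᶠ[𝓝 x] fun _ => 0 := by
      filter_upwards [h1] with y hy
      simp [hy]
    rw [h2.fderiv_eq, h1.fderiv_eq, h1.eq_of_nhds]
    simp

/-- The divergence theorem for the field `ψ (a x + b e_N)`, `ψ` a compactly supported function. -/
lemma integral_divergence_eq_zero {U : Set (E n)} (hU : IsOpen U)
    {ψ a b : E n → ℝ} (hψ : ContDiff ℝ 1 ψ) (hc : HasCompactSupport ψ) (hs : tsupport ψ ⊆ U)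
    (ha : ContDiffOn ℝ 1 a U) (hb : ContDiffOn ℝ 1 b U) :
    Integrable (fun x => ψ x * (fderiv ℝ a x x + ((n : ℝ) + 1) * a x + fderiv ℝ b x (lastVec n)) +
      (a x * fderiv ℝ ψ x x + b x * fderiv ℝ ψ x (lastVec n))) ∧
    ∫ x, (ψ x * (fderiv ℝ a x x + ((n : ℝ) + 1) * a x + fderiv ℝ b x (lastVec n)) +
      (a x * fderiv ℝ ψ x x + b x * fderiv ℝ ψ x (lastVec n))) = 0 := by
  have hA := contDiff_mul_of_tsupport_subset hU hψ hs ha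
  have hB := contDiff_mul_of_tsupport_subset hU hψ hs hb
  have hcA : HasCompactSupport (fun x => ψ x * a x) := hc.mul_right
  have hcB : HasCompactSupport (fun x => ψ x * b x) := hc.mul_right
  have e : ∀ x, ψ x * (fderiv ℝ a x x + ((n : ℝ) + 1) * a x + fderiv ℝ b x (lastVec n)) +
      (a x * fderiv ℝ ψ x x + b x * fderiv ℝ ψ x (lastVec n)) =
      (fderiv ℝ (fun x => ψ x * a x) x x + ((n : ℝ) + 1) * (ψ x * a x)) +
        fderiv ℝ (fun x => ψ x * b x) x (lastVec n) := by
    intro x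
    rw [fderiv_mul_of_tsupport_subset hU hψ hs ha, fderiv_mul_of_tsupport_subset hU hψ hs hb]
    ring
  have iA : Integrable
      (fun x => fderiv ℝ (fun x => ψ x * a x) x x + ((n : ℝ) + 1) * (ψ x * a x)) := by
    refine Integrable.add ?_ ((hA.continuous.integrable_of_hasCompactSupport hcA).const_mul _)
    refine ((hA.continuous_fderiv one_ne_zero).clm_apply
      continuous_id).integrable_of_hasCompactSupport ?_
    exact (hcA.fderiv (𝕜 := ℝ)).mono (fun x hx h => hx (by simp [h]))
  have iB : Integrable (fun x => fderiv ℝ (fun x => ψ x * b x) x (lastVec n)) :=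
    ((hB.continuous_fderiv one_ne_zero).clm_apply
      continuous_const).integrable_of_hasCompactSupport (hcB.fderiv_apply ℝ _)
  simp_rw [e]
  refine ⟨iA.add iB, ?_⟩
  rw [integral_add iA iB, integral_fderiv_apply_self_add hA hcA,
    integral_fderiv_apply_eq_zero hB hcB, add_zero]

lemma continuous_gradient {f : E n → ℝ} (hf : ContDiff ℝ 1 f) : Continuous (gradient f) :=
  (LinearIsometryEquiv.continuous _).comp (hf.continuous_fderiv one_ne_zero)

lemma _root_.HasCompactSupport.gradient {f : E n → ℝ} (hc : HasCompactSupport f) :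
    HasCompactSupport (gradient f) :=
  (hc.fderiv (𝕜 := ℝ)).mono (fun x hx h => hx (by simp [_root_.gradient, h]))

lemma norm_gradient (f : E n → ℝ) (x : E n) : ‖gradient f x‖ = ‖fderiv ℝ f x‖ := by
  simp [gradient]

lemma inner_gradient_single (f : E n → ℝ) (x : E n) (i : Fin (n + 1)) :
    gradient f x i = fderiv ℝ f x (EuclideanSpace.single i 1) := by
  rw [← inner_gradient_left (𝕜 := ℝ), EuclideanSpace.inner_single_right]
  simp

lemma integrable_norm_gradient_sq {u : E n → ℝ} (hu : ContDiff ℝ 1 u)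
    (hc : HasCompactSupport u) : Integrable (fun x => ‖gradient u x‖ ^ 2) := by
  refine ((continuous_gradient hu).norm.pow 2).integrable_of_hasCompactSupport ?_
  exact hc.gradient.mono (fun x hx h => hx (by simp [h]))

lemma integrable_sq {u : E n → ℝ} (hu : Continuous u)
    (hc : HasCompactSupport u) : Integrable (fun x => u x ^ 2) := by
  refine (hu.pow 2).integrable_of_hasCompactSupport ?_
  exact hc.mono (fun x hx h => hx (by simp [h]))

lemma tsupport_sq_subset (u : E n → ℝ) : tsupport (fun x => u x ^ 2) ⊆ tsupport u :=
  closure_mono fun x (hx : u x ^ 2 ≠ 0) (h : u x = 0) => hx (by simp [h])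

lemma integrable_sq_div_norm_sq {u : E n → ℝ} (hu : Continuous u)
    (hc : HasCompactSupport u) (h0 : (0 : E n) ∉ tsupport u) :
    Integrable (fun x => u x ^ 2 / ‖x‖ ^ 2) := by
  have hs : tsupport (fun x => u x ^ 2) ⊆ {0}ᶜ := fun x hx h =>
    h0 (mem_singleton_iff.1 h ▸ tsupport_sq_subset u hx)
  have hk : Continuous (fun x => u x ^ 2 * (‖x‖ ^ 2)⁻¹) :=
    continuous_mul_of_tsupport_subset isOpen_compl_singleton (hu.pow 2) hs
      (ContinuousOn.inv₀ (by fun_prop) (fun x hx => by simpa using hx))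
  refine hk.integrable_of_hasCompactSupport ?_
  exact hc.mono (fun x hx h => hx (by simp [h]))

lemma norm_sq_field (x : E n) (a b : ℝ) :
    ‖a • x + b • lastVec n‖ ^ 2 = a ^ 2 * ‖x‖ ^ 2 + 2 * a * b * x (Fin.last n) + b ^ 2 := by
  rw [norm_add_sq_real, inner_smul_left, inner_smul_right, EuclideanSpace.inner_single_right,
    norm_smul, norm_smul]
  simp [mul_pow]
  ring

/-- Hardy-type inequality with the weight `div X - |X|²`, for the vector field
`X = a x + b e_N`. -/
lemma integral_mul_sq_le_of_field {U : Set (E n)} (hU : IsOpen U)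
    {u a b V : E n → ℝ} (hu : ContDiff ℝ 1 u) (hc : HasCompactSupport u) (hs : tsupport u ⊆ U)
    (ha : ContDiffOn ℝ 1 a U) (hb : ContDiffOn ℝ 1 b U)
    (hVi : Integrable (fun x => V x * u x ^ 2))
    (hV : ∀ x ∈ tsupport u, V x ≤ fderiv ℝ a x x + ((n : ℝ) + 1) * a x + fderiv ℝ b x (lastVec n) -
      (a x ^ 2 * ‖x‖ ^ 2 + 2 * a x * b x * x (Fin.last n) + b x ^ 2)) :
    ∫ x, V x * u x ^ 2 ≤ ∫ x, ‖gradient u x‖ ^ 2 := by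
  have hc2 : HasCompactSupport (fun x => u x ^ 2) := hc.mono (fun x hx h => hx (by simp [h]))
  have hs2 : tsupport (fun x => u x ^ 2) ⊆ U :=
    (tsupport_sq_subset u).trans hs
  obtain ⟨hi, h0⟩ := integral_divergence_eq_zero hU (hu.pow 2) hc2 hs2 ha hb
  have hg := integrable_norm_gradient_sq hu hc
  calc ∫ x, V x * u x ^ 2 ≤ _ := integral_mono hVi (hi.add hg) (fun x => ?_)
    _ = _ := by rw [integral_add' hi hg, h0, zero_add]
  simp only [Pi.add_apply]
  have hd : ∀ v, fderiv ℝ (fun x => u x ^ 2) x v = 2 * u x * fderiv ℝ u x v := by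
    intro v
    rw [fderiv_fun_pow 2 (hu.differentiable one_ne_zero x)]
    simp
  rw [hd, hd]
  -- Expanding |∇u + uX|² ≥ 0 gives |∇u|² ≥ -X·∇(u²) - |X|²u²; adding the divergence of u²X, whose
  -- integral vanishes, turns the right side into (div X - |X|²)u².
  have hsq : 0 ≤ ‖gradient u x + u x • (a x • x + b x • lastVec n)‖ ^ 2 := by positivity
  rw [norm_add_sq_real, inner_smul_right, inner_add_right, inner_smul_right, inner_smul_right,
    inner_gradient_left, inner_gradient_left, norm_smul, mul_pow, norm_sq_field,
    Real.norm_eq_abs, sq_abs] at hsq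
  have hle : V x * u x ^ 2 ≤ (fderiv ℝ a x x + ((n : ℝ) + 1) * a x + fderiv ℝ b x (lastVec n) -
      (a x ^ 2 * ‖x‖ ^ 2 + 2 * a x * b x * x (Fin.last n) + b x ^ 2)) * u x ^ 2 := by
    by_cases hx : x ∈ tsupport u
    · exact mul_le_mul_of_nonneg_right (hV x hx) (sq_nonneg _)
    · simp [image_eq_zero_of_notMem_tsupport hx]
  linarith

/-! ### The local inequality near the origin -/

/-- A defining function of the sphere-like hypersurface `x_N = - k |x|²`. -/
noncomputable def height (k : ℝ) (x : E n) : ℝ := x (Fin.last n) + k * ‖x‖ ^ 2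

lemma contDiff_height (k : ℝ) {m : WithTop ℕ∞} : ContDiff ℝ m (height k : E n → ℝ) :=
  (contDiff_coord _).add (contDiff_const.mul (contDiff_norm_sq ℝ))

lemma hasFDerivAt_height (k : ℝ) (x : E n) : HasFDerivAt (height k)
    ((EuclideanSpace.proj (Fin.last n) : E n →L[ℝ] ℝ) + k • (2 • (innerSL ℝ x))) x :=
  (hasFDerivAt_coord _ x).add ((hasFDerivAt_norm_sq' x).const_mul k)

lemma fderiv_height_self (k : ℝ) (x : E n) :
    fderiv ℝ (height k) x x = x (Fin.last n) + 2 * k * ‖x‖ ^ 2 := by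
  rw [(hasFDerivAt_height k x).fderiv]
  simp
  ring

lemma fderiv_height_lastVec (k : ℝ) (x : E n) :
    fderiv ℝ (height k) x (lastVec n) = 1 + 2 * k * x (Fin.last n) := by
  rw [(hasFDerivAt_height k x).fderiv]
  simp [EuclideanSpace.inner_single_right]
  ring

/-- The logarithmic derivative of the profile in the height variable. -/
noncomputable def profile (s : ℝ) : ℝ := 1 / s - 1 / √s

lemma contDiffAt_profile {s : ℝ} (hs : 0 < s) : ContDiffAt ℝ 1 profile s :=
  (contDiffAt_const.div contDiffAt_id hs.ne').sub
    (contDiffAt_const.div (Real.contDiffAt_sqrt hs.ne') (Real.sqrt_pos.2 hs).ne')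

lemma hasDerivAt_profile {σ : ℝ} (hσ : 0 < σ) :
    HasDerivAt profile (-1 / σ ^ 4 + 1 / (2 * σ ^ 3)) (σ ^ 2) := by
  have h1 := (hasDerivAt_const (σ ^ 2) (1 : ℝ)).div (hasDerivAt_id (σ ^ 2))
    (by simpa using hσ.ne')
  have hq : √(σ ^ 2) = σ := Real.sqrt_sq hσ.le
  have h2 := (hasDerivAt_const (σ ^ 2) (1 : ℝ)).div (Real.hasDerivAt_sqrt (x := σ ^ 2)
    (by positivity)) (by rw [hq]; positivity)
  refine (h1.sub h2).congr_deriv ?_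
  rw [hq]
  simp
  field_simp
  ring

/-- The scalar inequality behind the weight estimate; `N` is the dimension. -/
lemma weight_le {N k ε σ q y : ℝ} (hN : 0 < N) (hk : 0 < k) (hσ : 0 < σ) (hq : 0 < q)
    (hh : σ ^ 2 = y + k * q) (h1 : σ ≤ 1 / 2) (h2 : N * σ ≤ ε) (h3 : 2 * k * N * σ ≤ 1)
    (hG : 1 / 2 ≤ 1 + 4 * k * y + 4 * k ^ 2 * q) {ψ ψ' : ℝ} (hψ : ψ = 1 / σ ^ 2 - 1 / σ)
    (hψ' : ψ' = -1 / σ ^ 4 + 1 / (2 * σ ^ 3)) :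
    (N ^ 2 / 4 - ε) / q ≤ (-2 * k * ψ' * (y + 2 * k * q) - N / q) + N * (-2 * k * ψ + N / 2 / q)
      + (-ψ' * (1 + 2 * k * y)) - ((-2 * k * ψ + N / 2 / q) ^ 2 * q
        + 2 * (-2 * k * ψ + N / 2 / q) * (-ψ) * y + (-ψ) ^ 2) := by
  -- This is -Δw/w for w = h e^{-2√h} |x|^{-N/2}, with σ = √h and |∇h|² = 1 + 4ky + 4k²q. The last
  -- term is what remains of Δh = 2kN after the cross term with |x|^{-N/2}; the h^{-3/2} term
  -- dominates it for small σ.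
  have e : (-2 * k * ψ' * (y + 2 * k * q) - N / q) + N * (-2 * k * ψ + N / 2 / q)
      + (-ψ' * (1 + 2 * k * y)) - ((-2 * k * ψ + N / 2 / q) ^ 2 * q
        + 2 * (-2 * k * ψ + N / 2 / q) * (-ψ) * y + (-ψ) ^ 2)
      = (N ^ 2 / 4 - N * σ) / q + ((3 / 2) / σ ^ 3 - 1 / σ ^ 2) * (1 + 4 * k * y + 4 * k ^ 2 * q)
        - k * N * (1 / σ ^ 2 - 1 / σ) := by
    obtain rfl : y = σ ^ 2 - k * q := by linarith
    subst hψ hψ'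
    field_simp
    ring
  rw [e]
  have a1 : (N ^ 2 / 4 - ε) / q ≤ (N ^ 2 / 4 - N * σ) / q := by gcongr
  have a2 : 1 / σ ^ 3 ≤ (3 / 2) / σ ^ 3 - 1 / σ ^ 2 := by
    have : 0 ≤ (1 / 2 - σ) / σ ^ 3 := div_nonneg (by linarith) (by positivity)
    have : (3 / 2) / σ ^ 3 - 1 / σ ^ 2 - 1 / σ ^ 3 = (1 / 2 - σ) / σ ^ 3 := by
      field_simp
      ring
    linarith
  have a3 : 1 / σ ^ 3 * (1 / 2) ≤
      ((3 / 2) / σ ^ 3 - 1 / σ ^ 2) * (1 + 4 * k * y + 4 * k ^ 2 * q) := by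
    gcongr
    exact le_trans (by positivity) a2
  have a4 : k * N * (1 / σ ^ 2 - 1 / σ) ≤ 1 / σ ^ 3 * (1 / 2) := by
    have : 1 / σ ^ 3 * (1 / 2) - k * N * (1 / σ ^ 2 - 1 / σ)
        = ((1 - 2 * k * N * σ) + 2 * k * N * σ ^ 2) / (2 * σ ^ 3) := by
      field_simp
      ring
    have : 0 ≤ ((1 - 2 * k * N * σ) + 2 * k * N * σ ^ 2) / (2 * σ ^ 3) :=
      div_nonneg (add_nonneg (by linarith) (by positivity)) (by positivity)
    linarith
  linarith

/-- Hardy's inequality with almost optimal constant for functions supported near the origin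
and above the hypersurface `x_N = - k |x|²`. -/
lemma hardy_near_zero {k ε : ℝ} (hk : 0 < k) (hε : 0 < ε) : ∃ δ : ℝ, 0 < δ ∧
    ∀ u : E n → ℝ, ContDiff ℝ 1 u → HasCompactSupport u →
      (∀ x ∈ tsupport u, 0 < height k x ∧ x ≠ 0 ∧ ‖x‖ ≤ δ) →
      (((n : ℝ) + 1) ^ 2 / 4 - ε) * ∫ x, u x ^ 2 / ‖x‖ ^ 2 ≤ ∫ x, ‖gradient u x‖ ^ 2 := by
  set N : ℝ := (n : ℝ) + 1 with hNdef
  have hN : 0 < N := by positivity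
  obtain ⟨s, hs0, hs1, hs2, hs3⟩ : ∃ s : ℝ, 0 < s ∧ s ≤ 1 / 2 ∧ N * s ≤ ε ∧ 2 * k * N * s ≤ 1 := by
    refine ⟨min (1 / 2) (min (ε / N) (1 / (2 * k * N))), by positivity, min_le_left _ _, ?_, ?_⟩
    · rw [mul_comm, ← le_div_iff₀ hN]
      exact (min_le_right _ _).trans (min_le_left _ _)
    · rw [mul_comm, ← le_div_iff₀ (by positivity)]
      exact (min_le_right _ _).trans (min_le_right _ _)
  -- The bound s²/2 ensures √h ≤ s, and 1/(8k) ensures |∇h|² ≥ 1/2.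
  refine ⟨min (s ^ 2 / 2) (1 / (8 * k)), by positivity, fun u hu hc hsupp => ?_⟩
  have hU : IsOpen {x : E n | 0 < height k x ∧ x ≠ 0} :=
    (isOpen_lt continuous_const (contDiff_height k (m := 0)).continuous).inter isOpen_ne
  set U := {x : E n | 0 < height k x ∧ x ≠ 0} with hUdef
  have hψ : ContDiffOn ℝ 1 (fun x : E n => profile (height k x)) U := fun x hx =>
    ((contDiffAt_profile hx.1).comp x (contDiff_height k).contDiffAt).contDiffWithinAt
  have hq : ContDiffOn ℝ 1 (fun x : E n => N / 2 / ‖x‖ ^ 2) U := fun x hx =>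
    (contDiffAt_const.div (contDiff_norm_sq ℝ).contDiffAt
      (by simpa using hx.2)).contDiffWithinAt
  -- Since ∇h = e_N + 2kx, these coefficients `a` and `b` make a x + b e_N equal to -∇ log(h
  -- e^{-2√h} |x|^{-N/2}); `profile` is the logarithmic derivative of s e^{-2√s}.
  have ha : ContDiffOn ℝ 1 (fun x : E n => -2 * k * profile (height k x) + N / 2 / ‖x‖ ^ 2) U :=
    (contDiffOn_const.mul hψ).add hq
  have hb : ContDiffOn ℝ 1 (fun x : E n => -profile (height k x)) U := hψ.neg
  have h0 : (0 : E n) ∉ tsupport u := fun h => (hsupp 0 h).2.1 rfl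
  have key := integral_mul_sq_le_of_field (V := fun x => (N ^ 2 / 4 - ε) / ‖x‖ ^ 2)
    hU hu hc (fun x hx => ⟨(hsupp x hx).1, (hsupp x hx).2.1⟩) ha hb ?_ ?_
  · refine le_trans (le_of_eq ?_) key
    rw [← integral_const_mul]
    congr with x
    ring
  · refine ((integrable_sq_div_norm_sq hu.continuous hc h0).const_mul (N ^ 2 / 4 - ε)).congr ?_
    refine Eventually.of_forall fun x => ?_
    simp only
    ring
  · intro x hx
    obtain ⟨hh, hx0, hxδ⟩ := hsupp x hx
    have hnx : 0 < ‖x‖ := norm_pos_iff.2 hx0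
    set σ := √(height k x) with hσdef
    have hσ : 0 < σ := Real.sqrt_pos.2 hh
    have hσ2 : σ ^ 2 = height k x := Real.sq_sqrt hh.le
    have d1 : HasFDerivAt (fun x : E n => profile (height k x))
        ((-1 / σ ^ 4 + 1 / (2 * σ ^ 3)) • fderiv ℝ (height k) x) x :=
      HasDerivAt.comp_hasFDerivAt (h₂ := profile) x (hσ2 ▸ hasDerivAt_profile hσ)
        ((contDiff_height k (m := 1)).differentiable one_ne_zero x).hasFDerivAt
    have d2 : HasFDerivAt (fun x : E n => N / 2 / ‖x‖ ^ 2)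
        ((-(N / 2) / (‖x‖ ^ 2) ^ 2) • (2 • innerSL ℝ x)) x := by
      have := HasDerivAt.comp_hasFDerivAt (f := fun x : E n => ‖x‖ ^ 2) x
        (((hasDerivAt_const (‖x‖ ^ 2) (N / 2)).div
        (hasDerivAt_id (‖x‖ ^ 2)) (by simpa using hx0))) (hasFDerivAt_norm_sq' x)
      refine this.congr_fderiv ?_
      simp
    have d3 := (d1.const_mul (-2 * k)).fun_add d2
    have hy : |x (Fin.last n)| ≤ ‖x‖ := by simpa using PiLp.norm_apply_le x (Fin.last n)
    have hy1 := abs_le.1 hy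
    have hδ1 : ‖x‖ ≤ s ^ 2 / 2 := hxδ.trans (min_le_left _ _)
    have hδ2 : k * ‖x‖ ≤ 1 / 8 := by
      have := hxδ.trans (min_le_right _ _)
      rw [le_div_iff₀ (by positivity)] at this
      linarith
    have hheq : height k x = x (Fin.last n) + k * ‖x‖ ^ 2 := rfl
    have hσs : σ ≤ s := by
      refine abs_le_of_sq_le_sq' ?_ hs0.le |>.2
      rw [hσ2, hheq]
      nlinarith
    have hw := weight_le (N := N) (k := k) (ε := ε) (σ := σ) (q := ‖x‖ ^ 2) (y := x (Fin.last n))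
      hN hk hσ (by positivity) hσ2 (hσs.trans hs1)
      ((mul_le_mul_of_nonneg_left hσs hN.le).trans hs2)
      ((mul_le_mul_of_nonneg_left hσs (by positivity)).trans hs3)
      (by nlinarith [sq_nonneg (k * ‖x‖)]) rfl rfl
    refine hw.trans (le_of_eq ?_)
    have f1 : fderiv ℝ (fun x : E n => -2 * k * profile (height k x) + N / 2 / ‖x‖ ^ 2) x x
        = -2 * k * (-1 / σ ^ 4 + 1 / (2 * σ ^ 3)) * (x (Fin.last n) + 2 * k * ‖x‖ ^ 2)
          - N / ‖x‖ ^ 2 := by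
      rw [HasFDerivAt.fderiv d3]
      simp only [add_apply, smul_apply,
        fderiv_height_self, innerSL_apply_apply, real_inner_self_eq_norm_sq, smul_eq_mul, nsmul_eq_mul]
      field_simp
      push_cast
      ring
    have f2 : fderiv ℝ (fun x : E n => -profile (height k x)) x (lastVec n)
        = -(-1 / σ ^ 4 + 1 / (2 * σ ^ 3)) * (1 + 2 * k * x (Fin.last n)) := by
      rw [HasFDerivAt.fderiv d1.fun_neg]
      simp only [neg_apply, smul_apply,
        fderiv_height_lastVec, smul_eq_mul]
      ring
    have f3 : profile (height k x) = 1 / σ ^ 2 - 1 / σ := by rw [profile, hσ2]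
    simp only [f1, f2, f3, ← hNdef]

/-! ### From the local inequality to all test functions -/

lemma IsTestFunction.contDiff_one {Ω : Set (E n)} {φ : E n → ℝ} (h : IsTestFunction Ω φ) :
    ContDiff ℝ 1 φ := h.1.of_le (by exact_mod_cast le_top)

lemma setIntegral_eq_integral_of_tsupport_subset {Ω : Set (E n)} {φ f : E n → ℝ}
    (h : tsupport φ ⊆ Ω) (hf : ∀ x, x ∉ tsupport φ → f x = 0) : ∫ x in Ω, f x = ∫ x, f x :=
  setIntegral_eq_integral_of_forall_compl_eq_zero fun x hx => hf x fun hx' => hx (h hx')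

lemma gradient_eq_zero_of_notMem_tsupport {φ : E n → ℝ} {x : E n} (hx : x ∉ tsupport φ) :
    gradient φ x = 0 := by
  rw [gradient, (notMem_tsupport_iff_eventuallyEq.1 hx).fderiv_eq]
  simp

lemma norm_sq_coord (x : E n) :
    ‖x‖ ^ 2 = ∑ i : Fin n, x i.castSucc ^ 2 + x (Fin.last n) ^ 2 := by
  rw [EuclideanSpace.real_norm_sq_eq, Fin.sum_univ_castSucc]

/-- Replacing |x'|² by |x|² only enlarges the region when γ < 0, and it makes the gradient of the
defining function a combination of x and e_N. -/
lemma height_pos_of_mem_paraboloid {γ : ℝ} (hγ : γ < 0) {x : E n} (hx : x ∈ paraboloid n γ) :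
    0 < height (-γ) x := by
  rw [height, norm_sq_coord]
  have : γ * ∑ i : Fin n, x i.castSucc ^ 2 < x (Fin.last n) := hx
  nlinarith [mul_nonneg (neg_pos.2 hγ).le (sq_nonneg (x (Fin.last n)))]

lemma IsHyperbolicDomain.zero_notMem {Ω : Set (E n)} (hΩ : IsHyperbolicDomain Ω) :
    (0 : E n) ∉ Ω := by
  have := hΩ.zero_mem_frontier
  rw [hΩ.isOpen.frontier_eq] at this
  exact this.2

/-- Young's inequality with weight η for the product rule; the gradient term keeps a factor
arbitrarily close to 1. -/
lemma norm_gradient_mul_sq_le {χ φ : E n → ℝ} (hχ : ContDiff ℝ 1 χ) (hφ : ContDiff ℝ 1 φ) {x : E n}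
    (h0 : 0 ≤ χ x) (h1 : χ x ≤ 1) {M η : ℝ} (hM : ‖fderiv ℝ χ x‖ ≤ M) (hη : 0 < η) :
    ‖gradient (fun x => χ x * φ x) x‖ ^ 2 ≤
      (1 + η) * ‖gradient φ x‖ ^ 2 + (1 + 1 / η) * M ^ 2 * φ x ^ 2 := by
  have hM0 : 0 ≤ M := (norm_nonneg _).trans hM
  rw [norm_gradient, norm_gradient,
    fderiv_fun_mul (hχ.differentiable one_ne_zero x) (hφ.differentiable one_ne_zero x)]
  set A := ‖fderiv ℝ φ x‖
  have hA : 0 ≤ A := norm_nonneg _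
  have hle : ‖χ x • fderiv ℝ φ x + φ x • fderiv ℝ χ x‖ ≤ A + |φ x| * M := by
    refine (norm_add_le _ _).trans (add_le_add ?_ ?_)
    · rw [norm_smul, Real.norm_eq_abs, abs_of_nonneg h0]
      exact mul_le_of_le_one_left hA h1
    · rw [norm_smul, Real.norm_eq_abs]
      gcongr
  have h2 : 0 ≤ (η * A - |φ x| * M) ^ 2 / η := by positivity
  calc _ ≤ (A + |φ x| * M) ^ 2 := by gcongr
    _ = (1 + η) * A ^ 2 + (1 + 1 / η) * M ^ 2 * |φ x| ^ 2 - (η * A - |φ x| * M) ^ 2 / η := by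
      field_simp
      ring
    _ ≤ (1 + η) * A ^ 2 + (1 + 1 / η) * M ^ 2 * |φ x| ^ 2 := by linarith
    _ = _ := by rw [sq_abs]

/-- The inequality for test functions. -/
lemma hardy_testFunction {Ω : Set (E n)} (hΩ : IsHyperbolicDomain Ω) {ε : ℝ} (hε : 0 < ε)
    (hε' : ε < ((n : ℝ) + 1) ^ 2 / 4) : ∃ C : ℝ, 0 < C ∧ ∀ φ : E n → ℝ, IsTestFunction Ω φ →
      (((n : ℝ) + 1) ^ 2 / 4 - ε) * ∫ x, φ x ^ 2 / ‖x‖ ^ 2 ≤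
        C * (∫ x, φ x ^ 2) + ∫ x, ‖gradient φ x‖ ^ 2 := by
  obtain ⟨γ, hγ, hsub⟩ := hΩ.subset_paraboloid
  set c : ℝ := ((n : ℝ) + 1) ^ 2 / 4 with hc
  have hcpos : 0 < c := by positivity
  obtain ⟨δ, hδ, hloc⟩ := hardy_near_zero (n := n) (neg_pos.2 hγ) (half_pos hε)
  rw [← hc] at hloc
  let χ : ContDiffBump (0 : E n) := ⟨δ / 2, δ, by positivity, by linarith⟩
  have hχ : ContDiff ℝ 1 (χ : E n → ℝ) := χ.contDiff
  obtain ⟨M, hM⟩ := (χ.hasCompactSupport.fderiv (𝕜 := ℝ)).exists_bound_of_continuous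
    (hχ.continuous_fderiv one_ne_zero)
  -- The local inequality is used with ε/2; the other half of ε pays for the factor 1 + η.
  set η := ε / (2 * c) with hηdef
  have hη : 0 < η := by positivity
  have hηc : (c - ε) * (1 + η) ≤ c - ε / 2 := by
    have : c * η = ε / 2 := by
      rw [hηdef]
      field_simp
    nlinarith [mul_pos hε hη]
  -- The first summand comes from the gradient of the cutoff, the second from |x| > δ/2, where
  -- 1/|x|² < 4/δ².
  refine ⟨(1 + 1 / η) * M ^ 2 + (c - ε) * (4 / δ ^ 2), ?_, fun φ hφ => ?_⟩
  · have : 0 < (c - ε) * (4 / δ ^ 2) := mul_pos (by linarith) (by positivity)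
    positivity
  have hφ1 := hφ.contDiff_one
  have h0φ : (0 : E n) ∉ tsupport φ := fun h => hΩ.zero_notMem (hφ.2.2 h)
  set u : E n → ℝ := fun x => χ x * φ x with hu
  have hu1 : ContDiff ℝ 1 u := hχ.mul hφ1
  have huc : HasCompactSupport u := hφ.2.1.mul_left
  have hts : tsupport u ⊆ tsupport φ := closure_mono fun x (hx : χ x * φ x ≠ 0) =>
    (right_ne_zero_of_mul hx : φ x ≠ 0)
  have hts' : tsupport u ⊆ tsupport χ := closure_mono fun x (hx : χ x * φ x ≠ 0) =>
    (left_ne_zero_of_mul hx : χ x ≠ 0)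
  have key := hloc u hu1 huc fun x hx => by
    refine ⟨height_pos_of_mem_paraboloid hγ (hsub (hφ.2.2 (hts hx))), ?_, ?_⟩
    · rintro rfl
      exact h0φ (hts hx)
    · have := hts' hx
      rw [χ.tsupport_eq] at this
      simpa using this
  have i1 := integrable_norm_gradient_sq hφ1 hφ.2.1
  have i2 := integrable_sq hφ1.continuous hφ.2.1
  have i3 := integrable_sq_div_norm_sq hφ1.continuous hφ.2.1 h0φ
  have i4 := integrable_sq_div_norm_sq hu1.continuous huc (fun h => h0φ (hts h))
  have hgrad : ∫ x, ‖gradient u x‖ ^ 2 ≤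
      (1 + η) * (∫ x, ‖gradient φ x‖ ^ 2) + (1 + 1 / η) * M ^ 2 * ∫ x, φ x ^ 2 := by
    rw [← integral_const_mul, ← integral_const_mul,
      ← integral_add (i1.const_mul _) (i2.const_mul _)]
    exact integral_mono (integrable_norm_gradient_sq hu1 huc)
      ((i1.const_mul _).add (i2.const_mul _))
      fun x => norm_gradient_mul_sq_le hχ hφ1 χ.nonneg χ.le_one (hM x) hη
  have hweight : ∫ x, φ x ^ 2 / ‖x‖ ^ 2 ≤
      (∫ x, u x ^ 2 / ‖x‖ ^ 2) + 4 / δ ^ 2 * ∫ x, φ x ^ 2 := by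
    rw [← integral_const_mul, ← integral_add i4 (i2.const_mul _)]
    refine integral_mono i3 (i4.add (i2.const_mul _)) fun x => ?_
    by_cases hx : ‖x‖ ≤ δ / 2
    · have : χ x = 1 := χ.one_of_mem_closedBall (by simpa [χ] using hx)
      simp only [hu, this, one_mul]
      exact le_add_of_nonneg_right (by positivity)
    · push Not at hx
      have h1 : φ x ^ 2 / ‖x‖ ^ 2 ≤ φ x ^ 2 / (δ / 2) ^ 2 := by gcongr
      have h2 : φ x ^ 2 / (δ / 2) ^ 2 = 4 / δ ^ 2 * φ x ^ 2 := by
        field_simp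
        ring
      have h3 : 0 ≤ u x ^ 2 / ‖x‖ ^ 2 := by positivity
      simp only
      linarith
  set I := ∫ x, φ x ^ 2
  set D := ∫ x, ‖gradient φ x‖ ^ 2
  set J := ∫ x, u x ^ 2 / ‖x‖ ^ 2
  have hI : 0 ≤ I := integral_nonneg fun x => by positivity
  have hJ : 0 ≤ J := integral_nonneg fun x => by positivity
  have hmain : (c - ε) * J ≤ D + (1 + 1 / η) * M ^ 2 * I := by
    have h1 : (1 + η) * ((c - ε) * J) ≤ (1 + η) * D + (1 + 1 / η) * M ^ 2 * I := by
      nlinarith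
    have h2 : 0 ≤ η * ((1 + 1 / η) * M ^ 2 * I) := by positivity
    have h3 : (1 + η) * ((c - ε) * J) ≤ (1 + η) * (D + (1 + 1 / η) * M ^ 2 * I) := by linarith
    exact le_of_mul_le_mul_left h3 (by positivity)
  have := mul_le_mul_of_nonneg_left hweight (by linarith : 0 ≤ c - ε)
  linarith

/-! ### Passage to H¹₀ -/

lemma tendsto_integral_norm_sq {F : Type*} [NormedAddCommGroup F] [InnerProductSpace ℝ F]
    {α : Type*} [MeasurableSpace α] {μ : Measure α} {f : ℕ → α → F} {g : α → F}
    (hf : ∀ k, MemLp (f k) 2 μ) (hg : MemLp g 2 μ)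
    (h : Tendsto (fun k => eLpNorm (fun x => f k x - g x) 2 μ) atTop (𝓝 0)) :
    Tendsto (fun k => ∫ x, ‖f k x‖ ^ 2 ∂μ) atTop (𝓝 (∫ x, ‖g x‖ ^ 2 ∂μ)) := by
  have e : ∀ (f : α → F) (hf : MemLp f 2 μ), ∫ x, ‖f x‖ ^ 2 ∂μ = ‖hf.toLp f‖ ^ 2 := by
    intro f hf
    rw [← real_inner_self_eq_norm_sq, L2.inner_def]
    refine integral_congr_ae ?_
    filter_upwards [hf.coeFn_toLp] with x hx
    rw [hx, real_inner_self_eq_norm_sq]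
  simp_rw [fun k => e (f k) (hf k), e g hg]
  exact ((Lp.tendsto_Lp_iff_tendsto_eLpNorm'' f hf g hg).2 h).norm.pow 2

/-- Fatou's lemma along an almost everywhere convergent subsequence of test functions gives both the
integrability and the inequality, since the right-hand sides converge. -/
lemma hardy_memH10 {Ω : Set (E n)} (hΩ : IsHyperbolicDomain Ω) {ε : ℝ} (hε : 0 < ε) :
    ∃ C : ℝ, 0 < C ∧ ∀ (v : E n → ℝ) (G : E n → E n), MemH10 Ω v G →
      IntegrableOn (fun x => v x ^ 2 / ‖x‖ ^ 2) Ω ∧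
      (((n : ℝ) + 1) ^ 2 / 4 - ε) * ∫ x in Ω, v x ^ 2 / ‖x‖ ^ 2 ≤
        C * (∫ x in Ω, v x ^ 2) + ∫ x in Ω, ‖G x‖ ^ 2 := by
  set c : ℝ := ((n : ℝ) + 1) ^ 2 / 4 with hc
  have hcpos : 0 < c := by positivity
  -- Shrinking ε keeps the Hardy constant positive, so that one can divide by it; the inequality for
  -- a larger ε is weaker.
  obtain ⟨C, hC, hT⟩ := hardy_testFunction hΩ (ε := min ε (c / 2)) (by positivity)
    ((min_le_right _ _).trans_lt (half_lt_self hcpos))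
  rw [← hc] at hT
  set d := c - min ε (c / 2) with hd
  have hdpos : 0 < d := sub_pos.2 ((min_le_right _ _).trans_lt (half_lt_self hcpos))
  refine ⟨C, hC, fun v G ⟨⟨hv, hG, _⟩, φ, hφ, hφv, hφG⟩ => ?_⟩
  have hmφ : ∀ k, MemLp (φ k) 2 (volume.restrict Ω) := fun k =>
    ((hφ k).1.continuous.memLp_of_hasCompactSupport (hφ k).2.1).restrict Ω
  have hmg : ∀ k, MemLp (gradient (φ k)) 2 (volume.restrict Ω) := fun k =>
    ((continuous_gradient (hφ k).contDiff_one).memLp_of_hasCompactSupport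
      (hφ k).2.1.gradient).restrict Ω
  obtain ⟨ns, hns, hae⟩ := (tendstoInMeasure_of_tendsto_eLpNorm (two_ne_zero)
    (fun k => (hmφ k).1) hv.1 hφv).exists_seq_tendsto_ae
  have t1 := (tendsto_integral_norm_sq hmφ hv hφv).comp hns.tendsto_atTop
  have t2 := (tendsto_integral_norm_sq hmg hG hφG).comp hns.tendsto_atTop
  simp only [Real.norm_eq_abs, sq_abs] at t1
  set R := (C * (∫ x in Ω, v x ^ 2) + ∫ x in Ω, ‖G x‖ ^ 2) / d with hR
  have hRnn : 0 ≤ R := by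
    have h1 : 0 ≤ ∫ x in Ω, v x ^ 2 := integral_nonneg fun x => by positivity
    have h2 : 0 ≤ ∫ x in Ω, ‖G x‖ ^ 2 := integral_nonneg fun x => by positivity
    positivity
  have t3 : Tendsto (fun j => ENNReal.ofReal ((C * (∫ x in Ω, φ (ns j) x ^ 2) +
      ∫ x in Ω, ‖gradient (φ (ns j)) x‖ ^ 2) / d)) atTop (𝓝 (ENNReal.ofReal R)) :=
    (ENNReal.continuous_ofReal.tendsto _).comp (((t1.const_mul C).add t2).div_const d)
  have hlin : ∫⁻ x in Ω, ENNReal.ofReal (v x ^ 2 / ‖x‖ ^ 2) ≤ ENNReal.ofReal R := by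
    calc ∫⁻ x in Ω, ENNReal.ofReal (v x ^ 2 / ‖x‖ ^ 2)
        = ∫⁻ x in Ω, liminf (fun j => ENNReal.ofReal (φ (ns j) x ^ 2 / ‖x‖ ^ 2)) atTop := by
          refine lintegral_congr_ae ?_
          filter_upwards [hae] with x hx
          exact (((ENNReal.continuous_ofReal.tendsto _).comp
            ((hx.pow 2).div_const (‖x‖ ^ 2))).liminf_eq).symm
      _ ≤ liminf (fun j => ∫⁻ x in Ω, ENNReal.ofReal (φ (ns j) x ^ 2 / ‖x‖ ^ 2)) atTop := by
          refine lintegral_liminf_le fun j => ?_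
          have := (hφ (ns j)).1.continuous.measurable
          fun_prop
      _ ≤ liminf (fun j => ENNReal.ofReal ((C * (∫ x in Ω, φ (ns j) x ^ 2) +
            ∫ x in Ω, ‖gradient (φ (ns j)) x‖ ^ 2) / d)) atTop := by
          refine liminf_le_liminf (Eventually.of_forall fun j => ?_)
          have hj := hφ (ns j)
          have h0 : (0 : E n) ∉ tsupport (φ (ns j)) := fun h => hΩ.zero_notMem (hj.2.2 h)
          rw [← ofReal_integral_eq_lintegral_ofReal
            (integrable_sq_div_norm_sq hj.1.continuous hj.2.1 h0).restrict
            (Eventually.of_forall fun x => by positivity)]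
          refine ENNReal.ofReal_le_ofReal ?_
          rw [le_div_iff₀' hdpos]
          rw [setIntegral_eq_integral_of_tsupport_subset hj.2.2 fun x hx => by
              simp [image_eq_zero_of_notMem_tsupport hx],
            setIntegral_eq_integral_of_tsupport_subset hj.2.2 fun x hx => by
              simp [image_eq_zero_of_notMem_tsupport hx],
            setIntegral_eq_integral_of_tsupport_subset hj.2.2 fun x hx => by
              simp [gradient_eq_zero_of_notMem_tsupport hx]]
          exact hT _ hj
      _ = ENNReal.ofReal R := t3.liminf_eq
  have hmeas : AEStronglyMeasurable (fun x => v x ^ 2 / ‖x‖ ^ 2) (volume.restrict Ω) := by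
    have := hv.1.aemeasurable
    exact AEMeasurable.aestronglyMeasurable (by fun_prop)
  have hnn : 0 ≤ᵐ[volume.restrict Ω] fun x => v x ^ 2 / ‖x‖ ^ 2 :=
    Eventually.of_forall fun x => by positivity
  refine ⟨⟨hmeas, ?_⟩, ?_⟩
  · rw [hasFiniteIntegral_iff_ofReal hnn]
    exact hlin.trans_lt ENNReal.ofReal_lt_top
  · have hI : ∫ x in Ω, v x ^ 2 / ‖x‖ ^ 2 ≤ R := by
      rw [integral_eq_lintegral_of_nonneg_ae hnn hmeas]
      exact ENNReal.toReal_le_of_le_ofReal hRnn hlin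
    have h0 : 0 ≤ ∫ x in Ω, v x ^ 2 / ‖x‖ ^ 2 := integral_nonneg fun x => by positivity
    calc (c - ε) * ∫ x in Ω, v x ^ 2 / ‖x‖ ^ 2 ≤ d * ∫ x in Ω, v x ^ 2 / ‖x‖ ^ 2 := by
          gcongr
          exact sub_le_sub_left (min_le_left _ _) _
      _ ≤ d * R := by gcongr
      _ = _ := by
        rw [hR]
        field_simp

/-! ### Sheared balls -/

/-- The squared length of the first `n` coordinates. -/
noncomputable def perpSq (x : E n) : ℝ := ∑ i : Fin n, x i.castSucc ^ 2

lemma perpSq_nonneg (x : E n) : 0 ≤ perpSq x := Finset.sum_nonneg fun _ _ => sq_nonneg _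

lemma contDiff_perpSq {m : WithTop ℕ∞} : ContDiff ℝ m (perpSq : E n → ℝ) :=
  ContDiff.sum fun _ _ => (contDiff_coord _).pow 2

lemma norm_sq_eq_perpSq (x : E n) : ‖x‖ ^ 2 = perpSq x + x (Fin.last n) ^ 2 := norm_sq_coord x

/-- The last coordinate after the shear `x_N ↦ x_N + K |x'|²`. -/
noncomputable def shearHeight (K : ℝ) (x : E n) : ℝ := x (Fin.last n) + K * perpSq x

/-- Defining function of the image of the ball `B_ρ(ρ e_N)` under the shear
`x_N ↦ x_N - K |x'|²`. -/
noncomputable def shearedBallFun (K ρ : ℝ) (x : E n) : ℝ :=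
  2 * ρ * shearHeight K x - perpSq x - shearHeight K x ^ 2

/-- The image of the ball `B_ρ(ρ e_N)` under the shear `x_N ↦ x_N - K |x'|²`. -/
def shearedBall (n : ℕ) (K ρ : ℝ) : Set (E n) := {x | 0 < shearedBallFun K ρ x}

lemma contDiff_shearHeight (K : ℝ) {m : WithTop ℕ∞} : ContDiff ℝ m (shearHeight K : E n → ℝ) :=
  (contDiff_coord _).add (contDiff_const.mul contDiff_perpSq)

lemma contDiff_shearedBallFun (K ρ : ℝ) {m : WithTop ℕ∞} :
    ContDiff ℝ m (shearedBallFun K ρ : E n → ℝ) :=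
  ((contDiff_const.mul (contDiff_shearHeight K)).sub contDiff_perpSq).sub
    ((contDiff_shearHeight K).pow 2)

lemma isOpen_shearedBall (K ρ : ℝ) : IsOpen (shearedBall n K ρ) :=
  isOpen_lt continuous_const (contDiff_shearedBallFun K ρ (m := 0)).continuous

lemma perpSq_add_smul_lastVec (x : E n) (t : ℝ) : perpSq (x + t • lastVec n) = perpSq x := by
  refine Finset.sum_congr rfl fun i _ => ?_
  have : i.castSucc ≠ Fin.last n := (Fin.castSucc_lt_last i).ne
  simp [this]

lemma last_add_smul_lastVec (x : E n) (t : ℝ) :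
    (x + t • lastVec n) (Fin.last n) = x (Fin.last n) + t := by
  simp

lemma mem_shearedBall_iff {K ρ : ℝ} (hρ : 0 < ρ) {x : E n} : x ∈ shearedBall n K ρ ↔
    x + (K * perpSq x) • lastVec n ∈ Metric.ball (ρ • lastVec n) ρ := by
  rw [mem_ball_iff_norm, ← abs_of_pos hρ, ← abs_norm, ← sq_lt_sq, abs_of_pos hρ, add_sub_assoc,
    ← sub_smul, norm_sq_eq_perpSq, perpSq_add_smul_lastVec, last_add_smul_lastVec]
  change 0 < 2 * ρ * shearHeight K x - perpSq x - shearHeight K x ^ 2 ↔ _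
  rw [shearHeight]
  constructor <;> intro h <;> nlinarith

lemma isConnected_shearedBall (K : ℝ) {ρ : ℝ} (hρ : 0 < ρ) : IsConnected (shearedBall n K ρ) := by
  have hcont : Continuous fun x : E n => x + (-(K * perpSq x)) • lastVec n := by
    have := (contDiff_perpSq (n := n) (m := 0)).continuous
    fun_prop
  have : shearedBall n K ρ =
      (fun x : E n => x + (-(K * perpSq x)) • lastVec n) '' Metric.ball (ρ • lastVec n) ρ := by
    ext x
    constructor
    · intro hx
      refine ⟨_, (mem_shearedBall_iff hρ).1 hx, ?_⟩
      simp only [perpSq_add_smul_lastVec]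
      rw [add_assoc, ← add_smul]
      simp
    · rintro ⟨y, hy, rfl⟩
      rw [mem_shearedBall_iff hρ, perpSq_add_smul_lastVec, add_assoc, ← add_smul]
      simpa using hy
  rw [this]
  exact ((convex_ball _ _).isConnected (Metric.nonempty_ball.2 hρ)).image _ hcont.continuousOn

lemma shearHeight_pos {K ρ : ℝ} (hρ : 0 < ρ) {x : E n} (hx : x ∈ shearedBall n K ρ) :
    0 < shearHeight K x := by
  have h : 0 < 2 * ρ * shearHeight K x - perpSq x - shearHeight K x ^ 2 := hx
  have := perpSq_nonneg x
  have h2 : 0 < 2 * ρ * shearHeight K x := by nlinarith [sq_nonneg (shearHeight K x)]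
  exact pos_of_mul_pos_right h2 (by positivity)

lemma shearedBall_subset_paraboloid {K ρ : ℝ} (hρ : 0 < ρ) :
    shearedBall n K ρ ⊆ paraboloid n (-K) := by
  intro x hx
  have h := shearHeight_pos hρ hx
  rw [shearHeight] at h
  change -K * perpSq x < x (Fin.last n)
  linarith

lemma isHyperbolicDomain_shearedBall {K ρ : ℝ} (hK : 0 < K) (hρ : 0 < ρ) :
    IsHyperbolicDomain (shearedBall n K ρ) where
  isOpen := isOpen_shearedBall K ρ
  isConnected := isConnected_shearedBall K hρ
  zero_mem_frontier := by
    rw [(isOpen_shearedBall K ρ).frontier_eq]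
    have hp : perpSq (0 : E n) = 0 := by simp [perpSq]
    have hev : ∀ t : ℝ, shearedBallFun K ρ (t • lastVec n : E n) = 2 * ρ * t - t ^ 2 := by
      intro t
      have h1 := perpSq_add_smul_lastVec (0 : E n) t
      have h2 := last_add_smul_lastVec (0 : E n) t
      rw [zero_add] at h1 h2
      rw [shearedBallFun, shearHeight, h1, h2, hp]
      simp
    constructor
    · have ht : Tendsto (fun t : ℝ => (t • lastVec n : E n)) (𝓝[>] 0) (𝓝 0) := by
        have : Continuous fun t : ℝ => (t • lastVec n : E n) := by fun_prop
        simpa using (this.tendsto 0).mono_left nhdsWithin_le_nhds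
      refine mem_closure_of_tendsto ht ?_
      filter_upwards [Ioo_mem_nhdsGT hρ] with t ht
      change 0 < shearedBallFun K ρ (t • lastVec n : E n)
      rw [hev]
      nlinarith [ht.1, ht.2]
    · intro h
      have h' : 0 < shearedBallFun K ρ (0 : E n) := h
      have := hev 0
      rw [zero_smul] at this
      rw [this] at h'
      norm_num at h'
  subset_paraboloid := ⟨-K, by linarith, shearedBall_subset_paraboloid hρ⟩

lemma isBounded_shearedBall {K ρ : ℝ} (hK : 0 < K) (hρ : 0 < ρ) :
    Bornology.IsBounded (shearedBall n K ρ) := by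
  refine (Metric.isBounded_closedBall (x := (0 : E n))
    (r := √(ρ ^ 2 + (2 * ρ + K * ρ ^ 2) ^ 2))).subset fun x hx => ?_
  have h0 := shearHeight_pos hρ hx
  have h : 0 < 2 * ρ * shearHeight K x - perpSq x - shearHeight K x ^ 2 := hx
  have hp := perpSq_nonneg x
  have h1 : perpSq x ≤ ρ ^ 2 := by nlinarith [sq_nonneg (shearHeight K x - ρ)]
  have h2 : shearHeight K x ≤ 2 * ρ := by nlinarith
  have h3 : x (Fin.last n) = shearHeight K x - K * perpSq x := by
    rw [shearHeight]
    ring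
  have h4 : K * perpSq x ≤ K * ρ ^ 2 := by gcongr
  have h5 : |x (Fin.last n)| ≤ 2 * ρ + K * ρ ^ 2 := by
    rw [abs_le, h3]
    constructor <;> nlinarith [mul_nonneg hK.le hp]
  rw [mem_closedBall_zero_iff]
  refine Real.le_sqrt_of_sq_le ?_
  rw [norm_sq_eq_perpSq, ← sq_abs (x (Fin.last n))]
  gcongr

/-- Write z for the sheared height. Above the paraboloid with coefficient -K/2, z > (K/2)|x'|² ≥
|x'|², and z ≤ 1 near 0, so 2ρz ≥ 4z exceeds |x'|² + z². -/
lemma containsParaboloidNearZero_shearedBall {K ρ : ℝ} (hK : 2 ≤ K) (hρ : 2 ≤ ρ) :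
    ContainsParaboloidNearZero (shearedBall n K ρ) := by
  refine ⟨-(K / 2), by linarith, 1 / K, by positivity, fun x ⟨hx, hxb⟩ => ?_⟩
  have hx' : -(K / 2) * perpSq x < x (Fin.last n) := hx
  rw [mem_ball_zero_iff] at hxb
  have hp := perpSq_nonneg x
  have hy : x (Fin.last n) ≤ ‖x‖ :=
    (le_abs_self _).trans (by simpa using PiLp.norm_apply_le x (Fin.last n))
  have hKx : K * ‖x‖ < 1 := by
    rw [lt_div_iff₀ (by linarith)] at hxb
    linarith
  have hn := norm_nonneg x
  have hsq := norm_sq_eq_perpSq x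
  have hps : perpSq x ≤ ‖x‖ ^ 2 := by nlinarith [sq_nonneg (x (Fin.last n))]
  have hnx : ‖x‖ ≤ 1 / 2 := by nlinarith
  have hz1 : K / 2 * perpSq x < shearHeight K x := by
    rw [shearHeight]
    linarith
  have hz2 : shearHeight K x ≤ 1 := by
    rw [shearHeight]
    nlinarith
  change 0 < 2 * ρ * shearHeight K x - perpSq x - shearHeight K x ^ 2
  have hz3 : perpSq x < shearHeight K x := by nlinarith
  nlinarith

/-- The defining function has no critical zero. A vanishing vertical derivative forces the sheared
height to be ρ, hence |x'|² = ρ² on the zero set; the derivative in the direction (x', 0) is then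
-2ρ² ≠ 0. -/
lemma hasSmoothBoundary_shearedBall {K ρ : ℝ} (hρ : 0 < ρ) :
    HasSmoothBoundary (shearedBall n K ρ) := by
  intro p hp
  refine ⟨univ, isOpen_univ, mem_univ _, shearedBallFun K ρ,
    (contDiff_shearedBallFun K ρ).contDiffOn, ?_, ?_⟩
  swap
  · ext x
    simp [shearedBall]
  have hp0 : shearedBallFun K ρ p = 0 :=
    (frontier_lt_subset_eq continuous_const
      (contDiff_shearedBallFun K ρ (m := 0)).continuous hp).symm
  intro hF
  have hdF : HasFDerivAt (shearedBallFun K ρ) (0 : E n →L[ℝ] ℝ) p := by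
    rw [← hF]
    exact ((contDiff_shearedBallFun K ρ (m := 1)).differentiable one_ne_zero p).hasFDerivAt
  have hcurve : ∀ v : E n, HasDerivAt (fun t : ℝ => shearedBallFun K ρ (p + t • v)) 0 0 := by
    intro v
    have h1 : HasDerivAt (fun t : ℝ => p + t • v) v 0 := by
      simpa using ((hasDerivAt_id (0 : ℝ)).smul_const v).const_add p
    have h2 : HasFDerivAt (shearedBallFun K ρ) (0 : E n →L[ℝ] ℝ) (p + (0 : ℝ) • v) := by
      simpa using hdF
    refine (h2.comp_hasDerivAt (0 : ℝ) h1).congr_deriv ?_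
    simp
  set z := shearHeight K p with hz
  have hpz : 2 * ρ * z - perpSq p - z ^ 2 = 0 := hp0
  have hid := hasDerivAt_id (0 : ℝ)
  have hzρ : z = ρ := by
    have h1 := hcurve (lastVec n)
    have e : (fun t : ℝ => shearedBallFun K ρ (p + t • lastVec n)) =
        fun t : ℝ => 2 * ρ * (z + t) - perpSq p - (z + t) ^ 2 := by
      ext t
      rw [shearedBallFun, shearHeight, perpSq_add_smul_lastVec, last_add_smul_lastVec, hz,
        shearHeight]
      ring
    rw [e] at h1
    have h2 : HasDerivAt (fun t : ℝ => 2 * ρ * (z + t) - perpSq p - (z + t) ^ 2)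
        (2 * ρ - 2 * z) 0 := by
      have := (((hid.const_add z).const_mul (2 * ρ)).sub_const (perpSq p)).sub
        ((hid.const_add z).pow 2)
      refine this.congr_deriv ?_
      simp
    linarith [h1.unique h2]
  set w : E n := p - p (Fin.last n) • lastVec n with hw
  have e : (fun t : ℝ => shearedBallFun K ρ (p + t • w)) = fun t : ℝ =>
      2 * ρ * (p (Fin.last n) + K * ((1 + t) ^ 2 * perpSq p)) - (1 + t) ^ 2 * perpSq p -
        (p (Fin.last n) + K * ((1 + t) ^ 2 * perpSq p)) ^ 2 := by
    ext t
    have h1 : perpSq (p + t • w) = (1 + t) ^ 2 * perpSq p := by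
      rw [perpSq, perpSq, Finset.mul_sum]
      refine Finset.sum_congr rfl fun i _ => ?_
      have : i.castSucc ≠ Fin.last n := (Fin.castSucc_lt_last i).ne
      simp [hw, this]
      ring
    have h2 : (p + t • w) (Fin.last n) = p (Fin.last n) := by simp [hw]
    rw [shearedBallFun, shearHeight, h1, h2]
  have h1 := hcurve w
  rw [e] at h1
  have g := ((hid.const_add 1).pow 2).mul_const (perpSq p)
  have g2 := (g.const_mul K).const_add (p (Fin.last n))
  have h2 := ((g2.const_mul (2 * ρ)).sub g).sub (g2.pow 2)
  have h3 := h1.unique h2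
  have hz' : p (Fin.last n) + K * perpSq p = ρ := by rw [← hzρ, hz, shearHeight]
  simp at h3
  rw [hzρ] at hpz
  have h4 : perpSq p = ρ ^ 2 := by linarith
  rw [hz'] at h3
  have h5 : 0 < perpSq p := by
    rw [h4]
    positivity
  nlinarith

/-- Compact sets that avoid the ray `x' = 0, x_N ≤ 0` lie in sheared balls. -/
lemma exists_subset_shearedBall {τ R : ℝ} (hτ : 0 < τ) (hR : 0 < R) :
    ∃ K ρ : ℝ, 2 ≤ K ∧ 2 ≤ ρ ∧
      {x : E n | ‖x‖ ≤ R ∧ τ ≤ x (Fin.last n) + ‖x‖} ⊆ shearedBall n K ρ := by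
  -- If x_N < τ/4, then |x| - x_N ≥ τ/2, so |x'|² = (|x| - x_N)(|x| + x_N) ≥ τ²/2, and this K lifts
  -- the sheared height to at least 1. Otherwise x_N itself is at least τ/4.
  set K := 2 * (R + 1) / τ ^ 2 + 2 with hK
  have hK2 : 2 ≤ K := by
    have : 0 < 2 * (R + 1) / τ ^ 2 := by positivity
    linarith
  set m := min (τ / 4) 1 with hm
  have hm0 : 0 < m := by positivity
  -- With sheared height at least m, this ρ makes the linear term 2ρz exceed the bounds for |x'|²
  -- and z².
  set ρ := (R ^ 2 + (R + K * R ^ 2) ^ 2 + 1) / (2 * m) + 2 with hρ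
  have hρ2 : 2 ≤ ρ := by
    have : 0 ≤ (R ^ 2 + (R + K * R ^ 2) ^ 2 + 1) / (2 * m) := by positivity
    linarith
  refine ⟨K, ρ, hK2, hρ2, fun x ⟨hxR, hxτ⟩ => ?_⟩
  have hp := perpSq_nonneg x
  have hsq := norm_sq_eq_perpSq x
  have hn := norm_nonneg x
  have hy := abs_le.1 (show |x (Fin.last n)| ≤ ‖x‖ by
    simpa using PiLp.norm_apply_le x (Fin.last n))
  have hpR : perpSq x ≤ R ^ 2 := by nlinarith [sq_nonneg (x (Fin.last n))]
  have hz : m ≤ shearHeight K x := by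
    rw [shearHeight]
    rcases le_or_gt (τ / 4) (x (Fin.last n)) with h | h
    · have : 0 ≤ K * perpSq x := by positivity
      linarith [min_le_left (τ / 4) 1]
    · have h1 : τ / 2 ≤ ‖x‖ - x (Fin.last n) := by linarith
      have h2 : τ ^ 2 / 2 ≤ perpSq x := by nlinarith
      have h3 : 2 * (R + 1) / τ ^ 2 * (τ ^ 2 / 2) = R + 1 := by field_simp
      have h4 : R + 1 ≤ K * perpSq x := by
        rw [← h3]
        gcongr
        linarith
      linarith [min_le_right (τ / 4) 1]
  have hz2 : shearHeight K x ≤ R + K * R ^ 2 := by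
    rw [shearHeight]
    gcongr
    linarith
  have h1 : R ^ 2 + (R + K * R ^ 2) ^ 2 + 1 ≤ 2 * ρ * m := by
    rw [hρ, show 2 * ((R ^ 2 + (R + K * R ^ 2) ^ 2 + 1) / (2 * m) + 2) * m =
      (R ^ 2 + (R + K * R ^ 2) ^ 2 + 1) + 4 * m by field_simp; ring]
    linarith
  have h2 : 2 * ρ * m ≤ 2 * ρ * shearHeight K x := by gcongr
  have h3 : shearHeight K x ^ 2 ≤ (R + K * R ^ 2) ^ 2 := by gcongr; linarith
  change 0 < 2 * ρ * shearHeight K x - perpSq x - shearHeight K x ^ 2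
  linarith

/-! ### A strict subsolution off a ray -/

/-- The function `q ↦ q^{-α} P(log q)`. -/
noncomputable def powLog (α : ℝ) (P : ℝ → ℝ) (q : ℝ) : ℝ := q ^ (-α) * P (Real.log q)

lemma hasDerivAt_powLog (α : ℝ) {P : ℝ → ℝ} {P' q : ℝ} (hq : 0 < q)
    (hP : HasDerivAt P P' (Real.log q)) :
    HasDerivAt (powLog α P) (q ^ (-(α + 1)) * (P' - α * P (Real.log q))) q := by
  have h1 : HasDerivAt (fun q : ℝ => q ^ (-α)) (-α * q ^ (-α - 1)) q :=
    Real.hasDerivAt_rpow_const (Or.inl hq.ne')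
  have h2 : HasDerivAt (fun q : ℝ => P (Real.log q)) (P' * q⁻¹) q :=
    HasDerivAt.comp q hP (Real.hasDerivAt_log hq.ne')
  refine (h1.mul h2).congr_deriv ?_
  have e1 : q ^ (-α - 1) = q ^ (-α) / q := Real.rpow_sub_one hq.ne' _
  have e2 : q ^ (-(α + 1)) = q ^ (-α) / q := by rw [← e1]; ring_nf
  rw [e1, e2]
  field_simp
  ring

lemma contDiffAt_powLog (α : ℝ) {P : ℝ → ℝ} {k : WithTop ℕ∞} (hP : ContDiff ℝ k P) {q : ℝ}
    (hq : 0 < q) : ContDiffAt ℝ k (powLog α P) q :=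
  (Real.contDiffAt_rpow_const_of_ne hq.ne').mul
    (hP.contDiffAt.comp q (Real.contDiffAt_log.2 hq.ne'))

/-- A function of one variable that is positive exactly on `(-8, 8)` and satisfies
`8 P'' + P > 0` there. -/
def cap (l : ℝ) : ℝ := (64 - l ^ 2) ^ 3

/-- The derivative of `cap`. -/
def cap' (l : ℝ) : ℝ := -6 * l * (64 - l ^ 2) ^ 2

/-- The second derivative of `cap`. -/
def cap'' (l : ℝ) : ℝ := (64 - l ^ 2) * (30 * l ^ 2 - 384)

lemma hasDerivAt_cap (l : ℝ) : HasDerivAt cap (cap' l) l := by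
  have := (((hasDerivAt_id l).pow 2).const_sub 64).pow 3
  refine this.congr_deriv ?_
  simp [cap']
  ring

lemma hasDerivAt_cap' (l : ℝ) : HasDerivAt cap' (cap'' l) l := by
  have := ((hasDerivAt_id l).const_mul (-6)).mul ((((hasDerivAt_id l).pow 2).const_sub 64).pow 2)
  refine this.congr_deriv ?_
  simp [cap'']
  ring

lemma contDiff_cap {k : WithTop ℕ∞} : ContDiff ℝ k cap := by
  unfold cap
  fun_prop

lemma contDiff_cap' {k : WithTop ℕ∞} : ContDiff ℝ k cap' := by
  unfold cap'
  fun_prop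

lemma cap_pos_iff {l : ℝ} : 0 < cap l ↔ l ^ 2 < 64 := by
  rw [cap, Odd.pow_pos_iff (by decide)]
  constructor <;> intro h <;> linarith

lemma cap_le (l : ℝ) : cap l ≤ 64 ^ 3 := by
  refine Odd.strictMono_pow (by decide : Odd 3) |>.monotone ?_
  nlinarith [sq_nonneg l]

/-- The interval is long enough for a bump vanishing at its ends to satisfy this; the polynomial
choice makes it an explicit factorization. -/
lemma eight_mul_cap''_add_cap_pos {l : ℝ} (hl : l ^ 2 < 64) : 0 < 8 * cap'' l + cap l := by
  have : 8 * cap'' l + cap l = (64 - l ^ 2) * (1024 + 112 * l ^ 2 + (l ^ 2) ^ 2) := by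
    rw [cap, cap'']
    ring
  rw [this]
  have : 0 < 64 - l ^ 2 := by linarith
  positivity

/-- `(x_N + |x|) |x|^{-N/2} P(log |x|²)`, a subsolution of `- Δ W = N² / (4 |x|²) W` where it is
positive. -/
noncomputable def subsol (x : E n) : ℝ :=
  (x (Fin.last n) + ‖x‖) * powLog (((n : ℝ) + 1) / 4) cap (‖x‖ ^ 2)

/-- The coefficient of `x` in the gradient of `subsol`. -/
noncomputable def subsolRad (x : E n) : ℝ :=
  2 * x (Fin.last n) * powLog (((n : ℝ) + 1) / 4 + 1)
      (fun l => cap' l - ((n : ℝ) + 1) / 4 * cap l) (‖x‖ ^ 2) +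
    2 * powLog (((n : ℝ) + 1) / 4 - 1 / 2 + 1)
      (fun l => cap' l - (((n : ℝ) + 1) / 4 - 1 / 2) * cap l) (‖x‖ ^ 2)

/-- The coefficient of `e_N` in the gradient of `subsol`. -/
noncomputable def subsolVert (x : E n) : ℝ := powLog (((n : ℝ) + 1) / 4) cap (‖x‖ ^ 2)

/-- The Laplacian of `subsol`, as the divergence of its gradient. -/
noncomputable def subsolLap (x : E n) : ℝ :=
  fderiv ℝ subsolRad x x + ((n : ℝ) + 1) * subsolRad x + fderiv ℝ subsolVert x (lastVec n)

lemma contDiffOn_powLog_norm_sq (α : ℝ) {P : ℝ → ℝ} {k : WithTop ℕ∞} (hP : ContDiff ℝ k P) :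
    ContDiffOn ℝ k (fun x : E n => powLog α P (‖x‖ ^ 2)) {0}ᶜ := fun x hx =>
  ((contDiffAt_powLog α hP (by have := norm_pos_iff.2 (show x ≠ 0 from hx); positivity)).comp x
    (contDiff_norm_sq ℝ).contDiffAt).contDiffWithinAt

lemma contDiffOn_subsol {k : WithTop ℕ∞} : ContDiffOn ℝ k (subsol : E n → ℝ) {0}ᶜ :=
  ((contDiff_coord _).contDiffOn.add
    (fun _ hx => (contDiffAt_norm ℝ hx).contDiffWithinAt)).mul
    (contDiffOn_powLog_norm_sq _ contDiff_cap)

lemma contDiffOn_subsolVert {k : WithTop ℕ∞} : ContDiffOn ℝ k (subsolVert : E n → ℝ) {0}ᶜ :=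
  contDiffOn_powLog_norm_sq _ contDiff_cap

lemma contDiffOn_subsolRad {k : WithTop ℕ∞} : ContDiffOn ℝ k (subsolRad : E n → ℝ) {0}ᶜ :=
  ((contDiff_const.mul (contDiff_coord _)).contDiffOn.mul
    (contDiffOn_powLog_norm_sq _ (contDiff_cap'.sub (contDiff_const.mul contDiff_cap)))).add
    (contDiffOn_const.mul
      (contDiffOn_powLog_norm_sq _ (contDiff_cap'.sub (contDiff_const.mul contDiff_cap))))

lemma continuousOn_subsolLap : ContinuousOn (subsolLap : E n → ℝ) {0}ᶜ := by
  have ho : IsOpen ({0}ᶜ : Set (E n)) := isOpen_compl_singleton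
  exact ((((contDiffOn_subsolRad (k := 1)).continuousOn_fderiv_of_isOpen ho le_rfl).clm_apply
    continuousOn_id).add (continuousOn_const.mul
    (contDiffOn_subsolRad (k := 0)).continuousOn)).add
    (((contDiffOn_subsolVert (k := 1)).continuousOn_fderiv_of_isOpen ho le_rfl).clm_apply
      continuousOn_const)

lemma hasFDerivAt_powLog_norm_sq (α : ℝ) {P : ℝ → ℝ} {P' : ℝ} {x : E n} (hx : x ≠ 0)
    (hP : HasDerivAt P P' (Real.log (‖x‖ ^ 2))) :
    HasFDerivAt (fun x : E n => powLog α P (‖x‖ ^ 2))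
      (((‖x‖ ^ 2) ^ (-(α + 1)) * (P' - α * P (Real.log (‖x‖ ^ 2)))) • (2 • innerSL ℝ x)) x :=
  HasDerivAt.comp_hasFDerivAt (h₂ := powLog α P) (f := fun x : E n => ‖x‖ ^ 2) x
    (hasDerivAt_powLog α (by have := norm_pos_iff.2 hx; positivity) hP) (hasFDerivAt_norm_sq' x)

lemma rpow_neg_sub_half {q : ℝ} (hq : 0 < q) (α : ℝ) : q ^ (-(α - 1 / 2)) = √q * q ^ (-α) := by
  rw [Real.sqrt_eq_rpow, ← Real.rpow_add hq]
  ring_nf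

lemma subsol_eq {x : E n} (hx : x ≠ 0) : subsol x =
    x (Fin.last n) * powLog (((n : ℝ) + 1) / 4) cap (‖x‖ ^ 2) +
      powLog (((n : ℝ) + 1) / 4 - 1 / 2) cap (‖x‖ ^ 2) := by
  have := norm_pos_iff.2 hx
  rw [subsol, powLog, powLog, rpow_neg_sub_half (by positivity), Real.sqrt_sq this.le]
  ring

lemma fderiv_subsol {x : E n} (hx : x ≠ 0) (v : E n) :
    fderiv ℝ subsol x v = inner ℝ (subsolRad x • x + subsolVert x • lastVec n) v := by
  have hev : subsol =ᶠ[𝓝 x] fun x : E n =>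
      x (Fin.last n) * powLog (((n : ℝ) + 1) / 4) cap (‖x‖ ^ 2) +
      powLog (((n : ℝ) + 1) / 4 - 1 / 2) cap (‖x‖ ^ 2) := by
    filter_upwards [isOpen_ne.mem_nhds hx] with y hy using subsol_eq hy
  have d := ((hasFDerivAt_coord (Fin.last n) x).fun_mul
    (hasFDerivAt_powLog_norm_sq (((n : ℝ) + 1) / 4) hx (hasDerivAt_cap _))).fun_add
    (hasFDerivAt_powLog_norm_sq (((n : ℝ) + 1) / 4 - 1 / 2) hx (hasDerivAt_cap _))
  rw [hev.fderiv_eq, d.fderiv, inner_add_left, inner_smul_left, inner_smul_left,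
    EuclideanSpace.inner_single_left, subsolRad, subsolVert]
  simp only [powLog, add_apply, smul_apply, smul_eq_mul, nsmul_eq_mul, innerSL_apply_apply,
    PiLp.proj_apply]
  simp
  ring

lemma gradient_subsol {x : E n} (hx : x ≠ 0) :
    gradient subsol x = subsolRad x • x + subsolVert x • lastVec n :=
  ext_inner_right ℝ fun v => by rw [inner_gradient_left, fderiv_subsol hx]

/-- The operator Δ + N²/(4|x|²) annihilates x_N |x|^{-N/2} and sends |x|^{1-N/2} to (N -
1)|x|^{-1-N/2}, which is the strict gain. The exponent -N/2 is critical, so P' drops out and only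
P'' enters besides this gain. -/
lemma subsolLap_add {x : E n} (hx : x ≠ 0) :
    ‖x‖ ^ 2 * (subsolLap x + ((n : ℝ) + 1) ^ 2 / 4 * (subsol x / ‖x‖ ^ 2)) =
      (‖x‖ ^ 2) ^ (-(((n : ℝ) + 1) / 4)) *
        (4 * cap'' (Real.log (‖x‖ ^ 2)) * (x (Fin.last n) + ‖x‖) +
          n * ‖x‖ * cap (Real.log (‖x‖ ^ 2))) := by
  have hn := norm_pos_iff.2 hx
  have hq : 0 < ‖x‖ ^ 2 := by positivity
  set α := ((n : ℝ) + 1) / 4 with hα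
  have hn4 : (n : ℝ) = 4 * α - 1 := by rw [hα]; ring
  have hP : ∀ (β l : ℝ), HasDerivAt (fun l => cap' l - β * cap l) (cap'' l - β * cap' l) l :=
    fun β l => (hasDerivAt_cap' l).sub ((hasDerivAt_cap l).const_mul β)
  have dV := hasFDerivAt_powLog_norm_sq α hx (hasDerivAt_cap _)
  have dR := (((hasFDerivAt_coord (Fin.last n) x).const_mul 2).fun_mul
    (hasFDerivAt_powLog_norm_sq (α + 1) hx (hP α _))).fun_add
    ((hasFDerivAt_powLog_norm_sq (α - 1 / 2 + 1) hx (hP (α - 1 / 2) _)).const_mul 2)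
  have eV : fderiv ℝ subsolVert x = _ := HasFDerivAt.fderiv dV
  have eR : fderiv ℝ subsolRad x = _ := HasFDerivAt.fderiv dR
  rw [subsolLap, eV, eR, subsol, subsolRad, ← hα]
  have e1 : (‖x‖ ^ 2) ^ (-(α + 1)) = (‖x‖ ^ 2) ^ (-α) / ‖x‖ ^ 2 := by
    rw [← Real.rpow_sub_one hq.ne']
    ring_nf
  have e2 : (‖x‖ ^ 2) ^ (-(α + 1 + 1)) = (‖x‖ ^ 2) ^ (-α) / (‖x‖ ^ 2) ^ 2 := by
    rw [show -(α + 1 + 1) = -α - (2 : ℕ) by push_cast; ring, Real.rpow_sub_natCast hq.ne']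
  have e3 : (‖x‖ ^ 2) ^ (-(α - 1 / 2)) = ‖x‖ * (‖x‖ ^ 2) ^ (-α) := by
    rw [rpow_neg_sub_half hq, Real.sqrt_sq hn.le]
  have e4 : (‖x‖ ^ 2) ^ (-(α - 1 / 2 + 1)) = ‖x‖ * (‖x‖ ^ 2) ^ (-α) / ‖x‖ ^ 2 := by
    rw [← e3, ← Real.rpow_sub_one hq.ne']
    ring_nf
  have e5 : (‖x‖ ^ 2) ^ (-(α - 1 / 2 + 1 + 1)) = ‖x‖ * (‖x‖ ^ 2) ^ (-α) / (‖x‖ ^ 2) ^ 2 := by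
    rw [← e3, show -(α - 1 / 2 + 1 + 1) = -(α - 1 / 2) - (2 : ℕ) by push_cast; ring,
      Real.rpow_sub_natCast hq.ne']
  simp only [powLog, add_apply, smul_apply, smul_eq_mul, nsmul_eq_mul, innerSL_apply_apply,
    PiLp.proj_apply, e1, e2, e4, e5, real_inner_self_eq_norm_sq,
    EuclideanSpace.inner_single_right]
  generalize (‖x‖ ^ 2) ^ (-α) = T
  generalize cap'' (Real.log (‖x‖ ^ 2)) = P2
  generalize cap' (Real.log (‖x‖ ^ 2)) = P1
  generalize cap (Real.log (‖x‖ ^ 2)) = P0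
  rw [hn4]
  simp
  field_simp
  ring

lemma subsol_pos {x : E n} (h : 0 < subsol x) : x ≠ 0 ∧ Real.log (‖x‖ ^ 2) ^ 2 < 64 ∧
    0 < x (Fin.last n) + ‖x‖ := by
  have hx : x ≠ 0 := by
    rintro rfl
    simp [subsol] at h
  have hn := norm_pos_iff.2 hx
  have hT : 0 < (‖x‖ ^ 2) ^ (-(((n : ℝ) + 1) / 4)) := by positivity
  have hy := abs_le.1 (show |x (Fin.last n)| ≤ ‖x‖ by
    simpa using PiLp.norm_apply_le x (Fin.last n))
  rw [subsol, powLog] at h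
  have h1 : 0 < x (Fin.last n) + ‖x‖ := by
    refine lt_of_le_of_ne (by linarith) fun h0 => ?_
    rw [← h0, zero_mul] at h
    exact lt_irrefl _ h
  have h2 := (pos_iff_pos_of_mul_pos h).1 h1
  exact ⟨hx, cap_pos_iff.1 ((pos_iff_pos_of_mul_pos h2).1 hT), h1⟩

/-- Only P'' < 0 needs care. Then the worst case is x_N = |x|, and since N - 1 ≥ 1 the claim reduces
to 8P'' + P > 0. -/
lemma subsolLap_add_pos (hn : 1 ≤ n) {x : E n} (h : 0 < subsol x) :
    0 < subsolLap x + ((n : ℝ) + 1) ^ 2 / 4 * (subsol x / ‖x‖ ^ 2) := by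
  obtain ⟨hx, hl, hpos⟩ := subsol_pos h
  have hnx := norm_pos_iff.2 hx
  have hT : 0 < (‖x‖ ^ 2) ^ (-(((n : ℝ) + 1) / 4)) := by positivity
  have hy := abs_le.1 (show |x (Fin.last n)| ≤ ‖x‖ by
    simpa using PiLp.norm_apply_le x (Fin.last n))
  have hn' : (1 : ℝ) ≤ n := by exact_mod_cast hn
  refine pos_of_mul_pos_right (a := ‖x‖ ^ 2) ?_ (by positivity)
  rw [subsolLap_add hx]
  refine mul_pos hT ?_
  set l := Real.log (‖x‖ ^ 2)
  have hc := cap_pos_iff.2 hl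
  have h8 := eight_mul_cap''_add_cap_pos hl
  have h1 : ‖x‖ * cap l ≤ n * ‖x‖ * cap l := by
    nlinarith [mul_pos hnx hc]
  rcases le_or_gt 0 (cap'' l) with h2 | h2
  · have : 0 ≤ 4 * cap'' l * (x (Fin.last n) + ‖x‖) := by positivity
    have := mul_pos hnx hc
    linarith
  · have : 4 * cap'' l * (2 * ‖x‖) ≤ 4 * cap'' l * (x (Fin.last n) + ‖x‖) :=
      mul_le_mul_of_nonpos_left (by linarith) (by linarith)
    nlinarith [mul_pos hnx h8]

/-- The annulus that contains the positivity set of `subsol`. -/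
def annulus (n : ℕ) : Set (E n) := {x | Real.exp (-8) ≤ ‖x‖ ^ 2 ∧ ‖x‖ ^ 2 ≤ Real.exp 8}

lemma norm_le_of_mem_annulus {x : E n} (hx : x ∈ annulus n) : ‖x‖ ≤ Real.exp 4 := by
  refine abs_le_of_sq_le_sq' ?_ (Real.exp_pos _).le |>.2
  rw [← Real.exp_nat_mul]
  refine hx.2.trans (le_of_eq ?_)
  norm_num

lemma isCompact_annulus : IsCompact (annulus n) := by
  refine Metric.isCompact_of_isClosed_isBounded ?_ ?_
  · have hc : Continuous fun x : E n => ‖x‖ ^ 2 := by fun_prop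
    exact (isClosed_le continuous_const hc).inter (isClosed_le hc continuous_const)
  · exact (Metric.isBounded_closedBall (x := (0 : E n)) (r := Real.exp 4)).subset fun x hx => by
      simpa using norm_le_of_mem_annulus hx

lemma annulus_subset : annulus n ⊆ {0}ᶜ := by
  rintro x hx rfl
  have := hx.1
  simp only [norm_zero, ne_eq, OfNat.ofNat_ne_zero, not_false_eq_true, zero_pow] at this
  exact absurd this (not_le.2 (Real.exp_pos _))

lemma mem_annulus_of_subsol_pos {x : E n} (h : 0 < subsol x) : x ∈ annulus n := by
  obtain ⟨hx, hl, -⟩ := subsol_pos h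
  have hn := norm_pos_iff.2 hx
  have hq : 0 < ‖x‖ ^ 2 := by positivity
  have := abs_lt_of_sq_lt_sq' (a := Real.log (‖x‖ ^ 2)) (b := 8) (by linarith) (by norm_num)
  exact ⟨(Real.le_log_iff_exp_le hq).1 this.1.le, (Real.log_le_iff_le_exp hq).1 this.2.le⟩

/-- On the positivity set the factors other than x_N + |x| are bounded, so a lower bound on W keeps
points of the annulus away from the ray. -/
lemma exists_le_of_le_subsol {t : ℝ} (ht : 0 < t) :
    ∃ τ : ℝ, 0 < τ ∧ ∀ x : E n, t ≤ subsol x → τ ≤ x (Fin.last n) + ‖x‖ := by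
  set Q := Real.exp (8 * (((n : ℝ) + 1) / 4)) * 64 ^ 3 with hQ
  have hQ0 : 0 < Q := by positivity
  refine ⟨t / Q, by positivity, fun x hx => ?_⟩
  have hpos := ht.trans_le hx
  obtain ⟨hx0, hl, hs⟩ := subsol_pos hpos
  have hn := norm_pos_iff.2 hx0
  have hq : 0 < ‖x‖ ^ 2 := by positivity
  rw [div_le_iff₀ hQ0]
  refine hx.trans ?_
  rw [subsol, powLog, hQ]
  have h8 := (abs_lt_of_sq_lt_sq' (a := Real.log (‖x‖ ^ 2)) (b := 8) (by linarith)
    (by norm_num)).1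
  have h1 : (‖x‖ ^ 2) ^ (-(((n : ℝ) + 1) / 4)) ≤ Real.exp (8 * (((n : ℝ) + 1) / 4)) := by
    rw [Real.rpow_def_of_pos hq]
    refine Real.exp_le_exp.2 ?_
    have : 0 ≤ ((n : ℝ) + 1) / 4 := by positivity
    nlinarith
  have h2 := cap_le (Real.log (‖x‖ ^ 2))
  have h3 := (cap_pos_iff.2 hl).le
  gcongr

/-- The singularity at the origin is harmless: W ≤ 0 off the annulus, so Φ ∘ W vanishes near 0. -/
lemma contDiff_comp_subsol {k : WithTop ℕ∞} {Φ : ℝ → ℝ} (hΦ : ContDiff ℝ k Φ)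
    (h0 : ∀ t ≤ 0, Φ t = 0) : ContDiff ℝ k (fun x : E n => Φ (subsol x)) := by
  rw [contDiff_iff_contDiffAt]
  intro x
  by_cases hx : x = 0
  · have hev : (fun x : E n => Φ (subsol x)) =ᶠ[𝓝 x] fun _ => 0 := by
      have : (annulus n)ᶜ ∈ 𝓝 x :=
        isCompact_annulus.isClosed.isOpen_compl.mem_nhds fun h => annulus_subset h hx
      filter_upwards [this] with y hy
      exact h0 _ (not_lt.1 fun h => hy (mem_annulus_of_subsol_pos h))
    exact contDiffAt_const.congr_of_eventuallyEq hev
  · exact hΦ.contDiffAt.comp x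
      (contDiffOn_subsol.contDiffAt (isOpen_compl_singleton.mem_nhds hx))

lemma tsupport_comp_subsol_subset {Φ : ℝ → ℝ} {t : ℝ} (h0 : ∀ s ≤ t, Φ s = 0) (ht : 0 ≤ t) :
    tsupport (fun x : E n => Φ (subsol x)) ⊆ annulus n := by
  refine closure_minimal (fun x hx => ?_) isCompact_annulus.isClosed
  exact mem_annulus_of_subsol_pos (ht.trans_lt (not_le.1 fun h => hx (h0 _ h)))

lemma gradient_comp_subsol {Φ : ℝ → ℝ} {Φ' : ℝ} {x : E n} (hx : x ≠ 0)
    (h : HasDerivAt Φ Φ' (subsol x)) :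
    gradient (fun x : E n => Φ (subsol x)) x = Φ' • gradient subsol x := by
  have d := (contDiffOn_subsol (k := 1)).contDiffAt (isOpen_compl_singleton.mem_nhds hx)
    |>.differentiableAt one_ne_zero
  have : HasFDerivAt (fun x : E n => Φ (subsol x)) (Φ' • fderiv ℝ subsol x) x :=
    HasDerivAt.comp_hasFDerivAt (h₂ := Φ) x h d.hasFDerivAt
  rw [gradient, this.fderiv, map_smul, gradient]

/-! ### Truncation and negative energy -/

open Real in
lemma deriv_smoothTransition_of_neg {s : ℝ} (hs : s < 0) : deriv smoothTransition s = 0 := by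
  have : smoothTransition =ᶠ[𝓝 s] fun _ => 0 := by
    filter_upwards [Iio_mem_nhds hs] with t ht using smoothTransition.zero_of_nonpos (le_of_lt ht)
  simp [this.deriv_eq]

open Real in
lemma deriv_smoothTransition_of_one_lt {s : ℝ} (hs : 1 < s) : deriv smoothTransition s = 0 := by
  have : smoothTransition =ᶠ[𝓝 s] fun _ => 1 := by
    filter_upwards [Ioi_mem_nhds hs] with t ht using smoothTransition.one_of_one_le (le_of_lt ht)
  simp [this.deriv_eq]

/-- The contribution of the transition layer of the cutoff. -/
noncomputable def layer (s : ℝ) : ℝ := s ^ 2 * deriv Real.smoothTransition (s - 1) ^ 2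

lemma layer_of_lt_one {s : ℝ} (hs : s < 1) : layer s = 0 := by
  rw [layer, deriv_smoothTransition_of_neg (by linarith)]
  simp

lemma layer_of_two_lt {s : ℝ} (hs : 2 < s) : layer s = 0 := by
  rw [layer, deriv_smoothTransition_of_one_lt (by linarith)]
  simp

lemma layer_nonneg (s : ℝ) : 0 ≤ layer s := by
  rw [layer]
  positivity

lemma exists_layer_le : ∃ M : ℝ, ∀ s, layer s ≤ M := by
  have hc : Continuous layer := by
    have := (Real.smoothTransition.contDiff (n := 1)).continuous_deriv le_rfl
    unfold layer
    fun_prop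
  obtain ⟨M, hM⟩ := (HasCompactSupport.intro (isCompact_Icc (a := (1 : ℝ)) (b := 2))
    (fun s hs => by
      by_cases h : s < 1
      · exact layer_of_lt_one h
      · exact layer_of_two_lt (not_le.1 fun h2 => hs ⟨not_lt.1 h, h2⟩))).exists_bound_of_continuous hc
  exact ⟨M, fun s => (le_abs_self _).trans (hM s)⟩

/-- The cut-off subsolution: `W θ(m W - 1)` with a smooth transition `θ`. -/
noncomputable def competitor (m : ℝ) (x : E n) : ℝ :=
  subsol x * Real.smoothTransition (m * subsol x - 1)

/-- The density of the energy of `competitor m` after an integration by parts. -/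
noncomputable def energyDensity (m : ℝ) (x : E n) : ℝ :=
  layer (m * subsol x) * ‖gradient subsol x‖ ^ 2 - Real.smoothTransition (m * subsol x - 1) ^ 2 *
    (subsol x * (subsolLap x + ((n : ℝ) + 1) ^ 2 / 4 * (subsol x / ‖x‖ ^ 2)))

lemma cutoff_eq_zero {m t : ℝ} (hm : 0 < m) (ht : t ≤ 1 / m) :
    Real.smoothTransition (m * t - 1) = 0 := by
  refine Real.smoothTransition.zero_of_nonpos ?_
  rw [le_div_iff₀ hm] at ht
  linarith

lemma contDiff_competitor {m : ℝ} (hm : 0 < m) : ContDiff ℝ ∞ (competitor m : E n → ℝ) :=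
  contDiff_comp_subsol (Φ := fun t => t * Real.smoothTransition (m * t - 1))
    (contDiff_id.mul (Real.smoothTransition.contDiff.comp
      ((contDiff_const.mul contDiff_id).sub contDiff_const)))
    fun t ht => by
      rw [cutoff_eq_zero hm (ht.trans (by positivity)), mul_zero]

lemma support_competitor_subset {m : ℝ} (hm : 0 < m) {x : E n} (hx : competitor m x ≠ 0) :
    1 / m < subsol x :=
  not_le.1 fun h => hx (by rw [competitor, cutoff_eq_zero hm h, mul_zero])

lemma tsupport_competitor_subset {m : ℝ} (hm : 0 < m) :
    tsupport (competitor m : E n → ℝ) ⊆ annulus n :=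
  tsupport_comp_subsol_subset (Φ := fun t => t * Real.smoothTransition (m * t - 1)) (t := 1 / m)
    (fun t ht => by rw [cutoff_eq_zero hm ht, mul_zero]) (by positivity)

lemma hasCompactSupport_competitor {m : ℝ} (hm : 0 < m) :
    HasCompactSupport (competitor m : E n → ℝ) :=
  isCompact_annulus.of_isClosed_subset (isClosed_tsupport _) (tsupport_competitor_subset hm)

lemma energyDensity_of_notMem {m : ℝ} (hm : 0 < m) {x : E n} (hx : x ∉ annulus n) :
    energyDensity m x = 0 := by
  have h : subsol x ≤ 0 := not_lt.1 fun h => hx (mem_annulus_of_subsol_pos h)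
  rw [energyDensity, cutoff_eq_zero hm (h.trans (by positivity)), layer_of_lt_one (by nlinarith)]
  simp

/-- For a cutoff θ, |∇(Wθ)|² = ∇W·∇(Wθ²) + W²|∇θ|². The divergence theorem for Wθ²∇W turns the first
term into -Wθ²ΔW; the second is the layer term. -/
lemma energy_competitor {m : ℝ} (hm : 0 < m) :
    Integrable (energyDensity m : E n → ℝ) ∧
    (∫ x : E n, ‖gradient (competitor m) x‖ ^ 2) -
      ((n : ℝ) + 1) ^ 2 / 4 * (∫ x : E n, competitor m x ^ 2 / ‖x‖ ^ 2) =
        ∫ x : E n, energyDensity m x := by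
  have hS : ∀ t, HasDerivAt (fun t => Real.smoothTransition (m * t - 1))
      (deriv Real.smoothTransition (m * t - 1) * m) t := by
    intro t
    have h1 : HasDerivAt (fun t : ℝ => m * t - 1) m t := by
      simpa using ((hasDerivAt_id t).const_mul m).sub_const 1
    exact HasDerivAt.comp t
      ((Real.smoothTransition.contDiff (n := 1)).differentiable one_ne_zero _).hasDerivAt h1
  have hF := fun t => (hasDerivAt_id t).fun_mul (hS t)
  have hH := fun t => (hasDerivAt_id t).fun_mul ((hS t).fun_pow 2)
  have hΦ : ContDiff ℝ 1 (fun t => t * Real.smoothTransition (m * t - 1) ^ 2) :=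
    contDiff_id.mul ((Real.smoothTransition.contDiff.comp
      ((contDiff_const.mul contDiff_id).sub contDiff_const)).pow 2)
  have hΦ0 : ∀ t ≤ 1 / m, t * Real.smoothTransition (m * t - 1) ^ 2 = 0 := fun t ht => by
    rw [cutoff_eq_zero hm ht]
    simp
  set ψ : E n → ℝ := fun x => subsol x * Real.smoothTransition (m * subsol x - 1) ^ 2 with hψdef
  have hψ : ContDiff ℝ 1 ψ :=
    contDiff_comp_subsol hΦ fun t ht => hΦ0 t (ht.trans (by positivity))
  have hψs : tsupport ψ ⊆ annulus n := tsupport_comp_subsol_subset hΦ0 (by positivity)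
  obtain ⟨hi, h0⟩ := integral_divergence_eq_zero (n := n) isOpen_compl_singleton hψ
    (isCompact_annulus.of_isClosed_subset (isClosed_tsupport _) hψs) (hψs.trans annulus_subset)
    contDiffOn_subsolRad contDiffOn_subsolVert
  have hu : ContDiff ℝ 1 (competitor m : E n → ℝ) :=
    (contDiff_competitor hm).of_le (by exact_mod_cast le_top)
  have hc := hasCompactSupport_competitor (n := n) hm
  have h0s : (0 : E n) ∉ tsupport (competitor m) := fun h =>
    annulus_subset (tsupport_competitor_subset hm h) rfl
  have i1 := integrable_norm_gradient_sq hu hc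
  have i2 := (integrable_sq_div_norm_sq hu.continuous hc h0s).const_mul (((n : ℝ) + 1) ^ 2 / 4)
  have hpt : ∀ x : E n, ‖gradient (competitor m) x‖ ^ 2 -
      ((n : ℝ) + 1) ^ 2 / 4 * (competitor m x ^ 2 / ‖x‖ ^ 2) -
      (ψ x * (fderiv ℝ subsolRad x x + ((n : ℝ) + 1) * subsolRad x +
          fderiv ℝ subsolVert x (lastVec n)) +
        (subsolRad x * fderiv ℝ ψ x x + subsolVert x * fderiv ℝ ψ x (lastVec n))) =
      energyDensity m x := by
    intro x
    by_cases hx : x ∈ annulus n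
    · have hx0 : x ≠ 0 := annulus_subset hx
      have g1 : gradient (competitor m) x = _ := gradient_comp_subsol hx0 (hF (subsol x))
      have g2 : gradient ψ x = _ := gradient_comp_subsol hx0 (hH (subsol x))
      have g3 : subsolRad x * fderiv ℝ ψ x x + subsolVert x * fderiv ℝ ψ x (lastVec n) =
          inner ℝ (gradient ψ x) (gradient subsol x) := by
        rw [inner_gradient_left, gradient_subsol hx0, map_add, map_smul, map_smul, smul_eq_mul,
          smul_eq_mul]
      rw [g3, g2, g1, norm_smul, mul_pow, inner_smul_left, real_inner_self_eq_norm_sq,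
        Real.norm_eq_abs, sq_abs, energyDensity, layer, competitor, subsolLap, hψdef]
      simp only [id, conj_trivial]
      ring
    · have hx1 := fun h => hx (tsupport_competitor_subset hm h)
      have hx2 := fun h => hx (hψs h)
      rw [energyDensity_of_notMem hm hx, gradient_eq_zero_of_notMem_tsupport hx1,
        image_eq_zero_of_notMem_tsupport hx1, image_eq_zero_of_notMem_tsupport hx2,
        (notMem_tsupport_iff_eventuallyEq.1 hx2).fderiv_eq]
      simp
  refine ⟨((i1.sub i2).sub hi).congr (Eventually.of_forall hpt), ?_⟩
  simp_rw [← hpt]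
  have i3 : Integrable (fun x : E n => ‖gradient (competitor m) x‖ ^ 2 -
      ((n : ℝ) + 1) ^ 2 / 4 * (competitor m x ^ 2 / ‖x‖ ^ 2)) := i1.sub i2
  rw [integral_sub i3 hi, h0, integral_sub i1 i2, integral_const_mul, sub_zero]

/-- At a fixed point the sequence is eventually constant: once mW > 2 the cutoff is 1 and the layer
has passed. -/
lemma tendsto_energyDensity (x : E n) :
    Tendsto (fun j : ℕ => energyDensity ((j : ℝ) + 1) x) atTop (𝓝 (if 0 < subsol x then
      -(subsol x * (subsolLap x + ((n : ℝ) + 1) ^ 2 / 4 * (subsol x / ‖x‖ ^ 2))) else 0)) := by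
  refine tendsto_const_nhds.congr' ?_
  split_ifs with h
  · filter_upwards [eventually_gt_atTop ⌈2 / subsol x⌉₊] with j hj
    have h1 : 2 < ((j : ℝ) + 1) * subsol x := by
      have : 2 / subsol x < j := (Nat.le_ceil _).trans_lt (by exact_mod_cast hj)
      rw [div_lt_iff₀ h] at this
      linarith
    simp only [energyDensity]
    rw [layer_of_two_lt h1, Real.smoothTransition.one_of_one_le (by linarith)]
    ring
  · refine Eventually.of_forall fun j => ?_
    have hj : (0 : ℝ) < (j : ℝ) + 1 := by positivity
    push Not at h
    simp only [energyDensity]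
    rw [cutoff_eq_zero hj (h.trans (by positivity)),
      layer_of_lt_one (by nlinarith)]
    simp

/-- In the layer W is of size 1/m while the cutoff varies at rate m in W; the product `layer`
depends on mW only, so its bound is uniform in m. -/
lemma exists_energyDensity_bound : ∃ M : ℝ, ∀ (j : ℕ) (x : E n),
    ‖energyDensity ((j : ℝ) + 1) x‖ ≤ (annulus n).indicator (fun _ => M) x := by
  obtain ⟨M₀, hM₀⟩ := exists_layer_le
  have hW : ContinuousOn (subsol : E n → ℝ) {0}ᶜ := (contDiffOn_subsol (k := 0)).continuousOn
  have hq : ContinuousOn (fun x : E n => ‖x‖ ^ 2) {0}ᶜ := by fun_prop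
  have hg : ContinuousOn (fun x : E n => ‖gradient subsol x‖ ^ 2) {0}ᶜ := by
    refine ContinuousOn.pow (ContinuousOn.norm ?_) 2
    refine ContinuousOn.congr (f := fun x : E n => subsolRad x • x + subsolVert x • lastVec n) ?_
      fun x hx => gradient_subsol hx
    exact ((contDiffOn_subsolRad (k := 0)).continuousOn.smul continuousOn_id).add
      ((contDiffOn_subsolVert (k := 0)).continuousOn.smul continuousOn_const)
  have hL : ContinuousOn (fun x : E n =>
      subsol x * (subsolLap x + ((n : ℝ) + 1) ^ 2 / 4 * (subsol x / ‖x‖ ^ 2))) {0}ᶜ :=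
    hW.mul (continuousOn_subsolLap.add (continuousOn_const.mul
      (hW.div hq fun x hx => by simpa using hx)))
  obtain ⟨M₁, hM₁⟩ := isCompact_annulus.exists_bound_of_continuousOn (hg.mono annulus_subset)
  obtain ⟨M₂, hM₂⟩ := isCompact_annulus.exists_bound_of_continuousOn (hL.mono annulus_subset)
  refine ⟨M₀ * M₁ + M₂, fun j x => ?_⟩
  by_cases hx : x ∈ annulus n
  · rw [indicator_of_mem hx, energyDensity]
    refine (norm_sub_le _ _).trans (add_le_add ?_ ?_)
    · rw [norm_mul, Real.norm_of_nonneg (layer_nonneg _)]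
      exact mul_le_mul (hM₀ _) (hM₁ x hx) (norm_nonneg _) ((layer_nonneg _).trans (hM₀ 0))
    · rw [norm_mul]
      refine le_trans ?_ (hM₂ x hx)
      refine mul_le_of_le_one_left (norm_nonneg _) ?_
      rw [norm_pow, Real.norm_of_nonneg (Real.smoothTransition.nonneg _)]
      exact pow_le_one₀ (Real.smoothTransition.nonneg _) (Real.smoothTransition.le_one _)
  · rw [indicator_of_notMem hx, energyDensity_of_notMem (by positivity) hx, norm_zero]

lemma exists_energy_neg (hn : 1 ≤ n) : ∃ m : ℝ, 0 < m ∧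
    (∫ x : E n, ‖gradient (competitor m) x‖ ^ 2) <
      ((n : ℝ) + 1) ^ 2 / 4 * (∫ x : E n, competitor m x ^ 2 / ‖x‖ ^ 2) := by
  obtain ⟨M, hM⟩ := exists_energyDensity_bound (n := n)
  have hpos : ∀ j : ℕ, (0 : ℝ) < (j : ℝ) + 1 := fun j => by positivity
  set F : E n → ℝ := fun x => if 0 < subsol x then
      -(subsol x * (subsolLap x + ((n : ℝ) + 1) ^ 2 / 4 * (subsol x / ‖x‖ ^ 2))) else 0 with hF
  have hmeas : ∀ j : ℕ, AEStronglyMeasurable (energyDensity ((j : ℝ) + 1) : E n → ℝ) volume :=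
    fun j => (energy_competitor (hpos j)).1.1
  have hbi : Integrable ((annulus n).indicator (fun _ => M)) :=
    (integrable_indicator_iff isCompact_annulus.isClosed.measurableSet).2
      (integrableOn_const isCompact_annulus.measure_lt_top.ne)
  have hlim := tendsto_integral_of_dominated_convergence
    ((annulus n).indicator (fun _ => M)) hmeas hbi
    (fun j => Eventually.of_forall (hM j)) (Eventually.of_forall tendsto_energyDensity)
  have hFm : AEStronglyMeasurable F volume :=
    aestronglyMeasurable_of_tendsto_ae atTop hmeas (Eventually.of_forall tendsto_energyDensity)
  have hFi : Integrable F := hbi.mono' hFm (Eventually.of_forall fun x =>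
    le_of_tendsto (tendsto_energyDensity x).norm (Eventually.of_forall fun j => hM j x))
  have hFneg : ∀ x, 0 < subsol x → F x < 0 := fun x hx => by
    simp only [hF, if_pos hx, neg_lt_zero]
    exact mul_pos hx (subsolLap_add_pos hn hx)
  have hFint : ∫ x, F x < 0 := by
    have hnn : 0 ≤ -F := fun x => by
      rw [Pi.neg_apply, Pi.zero_apply, neg_nonneg]
      by_cases hx : 0 < subsol x
      · exact (hFneg x hx).le
      · simp [hF, hx]
    have h1 : 0 < ∫ x, (-F) x := by
      rw [integral_pos_iff_support_of_nonneg hnn hFi.neg]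
      have ho : IsOpen ({0}ᶜ ∩ subsol ⁻¹' Ioi 0 : Set (E n)) :=
        (contDiffOn_subsol (k := 0)).continuousOn.isOpen_inter_preimage isOpen_compl_singleton
          isOpen_Ioi
      have hne : ({0}ᶜ ∩ subsol ⁻¹' Ioi 0 : Set (E n)).Nonempty := by
        have hs : 0 < subsol (lastVec n) := by
          simp [subsol, powLog, cap]
        exact ⟨lastVec n, (subsol_pos hs).1, hs⟩
      refine (ho.measure_pos volume hne).trans_le (measure_mono fun x hx => ?_)
      have := hFneg x hx.2
      simp only [Function.mem_support, Pi.neg_apply, ne_eq, neg_eq_zero]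
      exact this.ne
    simp only [Pi.neg_apply, integral_neg] at h1
    linarith
  obtain ⟨j, hj⟩ := ((hlim.eventually (gt_mem_nhds hFint))).exists
  refine ⟨(j : ℝ) + 1, hpos j, ?_⟩
  rw [← (energy_competitor (hpos j)).2] at hj
  linarith

/-! ### Failure of the inequality without the L² term -/

lemma IsTestFunction.memH10 {Ω : Set (E n)} {v : E n → ℝ} (hv : IsTestFunction Ω v) :
    MemH10 Ω v (gradient v) := by
  have hv1 := hv.contDiff_one
  refine ⟨⟨(hv1.continuous.memLp_of_hasCompactSupport hv.2.1).restrict Ω,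
    ((continuous_gradient hv1).memLp_of_hasCompactSupport hv.2.1.gradient).restrict Ω,
    fun φ hφ i => ?_⟩, fun _ => v, fun _ => hv, by simp, by simp⟩
  have hφ1 := hφ.contDiff_one
  rw [setIntegral_eq_integral_of_tsupport_subset hv.2.2 fun x hx => by
      simp [image_eq_zero_of_notMem_tsupport hx],
    setIntegral_eq_integral_of_tsupport_subset hv.2.2 fun x hx => by
      simp [gradient_eq_zero_of_notMem_tsupport hx]]
  simp_rw [inner_gradient_single]
  refine integral_mul_fderiv_eq_neg_fderiv_mul_of_integrable ?_ ?_ ?_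
    (fun x _ => hv1.differentiable one_ne_zero x) (fun x _ => hφ1.differentiable one_ne_zero x)
  · exact (((hv1.continuous_fderiv one_ne_zero).clm_apply continuous_const).mul
      hφ1.continuous).integrable_of_hasCompactSupport hφ.2.1.mul_left
  · exact (hv1.continuous.mul ((hφ1.continuous_fderiv one_ne_zero).clm_apply
      continuous_const)).integrable_of_hasCompactSupport hv.2.1.mul_right
  · exact (hv1.continuous.mul hφ1.continuous).integrable_of_hasCompactSupport hv.2.1.mul_right

/-- The competitor comes first; the domain is then chosen around its support. -/
lemma exists_domain_hardy_fails (hn : 1 ≤ n) :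
    ∃ Ω : Set (E n), IsHyperbolicDomain Ω ∧ Bornology.IsBounded Ω ∧ HasSmoothBoundary Ω ∧
      ContainsParaboloidNearZero Ω ∧ ∃ ε₀ : ℝ, 0 < ε₀ ∧ ∀ ε : ℝ, 0 < ε → ε < ε₀ →
        ∃ (v : E n → ℝ) (G : E n → E n), MemH10 Ω v G ∧
          ∫ x in Ω, ‖G x‖ ^ 2 <
            (((n : ℝ) + 1) ^ 2 / 4 - ε) * ∫ x in Ω, v x ^ 2 / ‖x‖ ^ 2 := by
  obtain ⟨m, hm, hneg⟩ := exists_energy_neg hn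
  obtain ⟨τ, hτ, hτ'⟩ := exists_le_of_le_subsol (n := n) (one_div_pos.2 hm)
  obtain ⟨K, ρ, hK, hρ, hsub⟩ := exists_subset_shearedBall (n := n) hτ (Real.exp_pos 4)
  have hclosed : IsClosed {x : E n | ‖x‖ ≤ Real.exp 4 ∧ τ ≤ x (Fin.last n) + ‖x‖} :=
    (isClosed_le continuous_norm continuous_const).inter (isClosed_le continuous_const
      (((contDiff_coord (Fin.last n) (k := 0)).continuous).fun_add continuous_norm))
  have hts : tsupport (competitor m : E n → ℝ) ⊆ shearedBall n K ρ := by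
    refine (closure_minimal (fun x hx => ?_) hclosed).trans hsub
    have h := support_competitor_subset hm hx
    exact ⟨norm_le_of_mem_annulus (mem_annulus_of_subsol_pos ((one_div_pos.2 hm).trans h)),
      hτ' x h.le⟩
  have htest : IsTestFunction (shearedBall n K ρ) (competitor m) :=
    ⟨contDiff_competitor hm, hasCompactSupport_competitor hm, hts⟩
  refine ⟨shearedBall n K ρ, isHyperbolicDomain_shearedBall (by linarith) (by linarith),
    isBounded_shearedBall (by linarith) (by linarith), hasSmoothBoundary_shearedBall (by linarith),
    containsParaboloidNearZero_shearedBall hK hρ, ?_⟩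
  set D := ∫ x : E n, ‖gradient (competitor m) x‖ ^ 2 with hD
  set J := ∫ x : E n, competitor m x ^ 2 / ‖x‖ ^ 2 with hJ
  have hD0 : 0 ≤ D := integral_nonneg fun x => by positivity
  have hJ0 : 0 < J := pos_of_mul_pos_right (hD0.trans_lt hneg) (by positivity)
  -- ε₀ is the gap between N²/4 and the competitor's Rayleigh quotient, so one function serves every
  -- ε < ε₀.
  refine ⟨((n : ℝ) + 1) ^ 2 / 4 - D / J, ?_, fun ε _ hε => ⟨competitor m, gradient (competitor m),
    htest.memH10, ?_⟩⟩
  · rw [sub_pos, div_lt_iff₀ hJ0]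
    exact hneg
  · rw [setIntegral_eq_integral_of_tsupport_subset hts fun x hx => by
        simp [gradient_eq_zero_of_notMem_tsupport hx],
      setIntegral_eq_integral_of_tsupport_subset hts fun x hx => by
        simp [image_eq_zero_of_notMem_tsupport hx], ← hD, ← hJ, ← div_lt_iff₀ hJ0]
    linarith

end HyperbolicHardy

/-- Here `N = n + 1 ≥ 2`. -/
theorem theorem2p4 (n : ℕ) (hn : 1 ≤ n) :
    (∀ Ω : Set (HyperbolicHardy.E n), HyperbolicHardy.IsHyperbolicDomain Ω →
      ∀ ε : ℝ, 0 < ε → ∃ C : ℝ, 0 < C ∧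
        ∀ (v : HyperbolicHardy.E n → ℝ) (G : HyperbolicHardy.E n → HyperbolicHardy.E n),
          HyperbolicHardy.MemH10 Ω v G →
            IntegrableOn (fun x => v x ^ 2 / ‖x‖ ^ 2) Ω ∧
            (((n : ℝ) + 1) ^ 2 / 4 - ε) * ∫ x in Ω, v x ^ 2 / ‖x‖ ^ 2 ≤
              C * (∫ x in Ω, v x ^ 2) + ∫ x in Ω, ‖G x‖ ^ 2) ∧
    (∃ Ω : Set (HyperbolicHardy.E n), HyperbolicHardy.IsHyperbolicDomain Ω ∧
      Bornology.IsBounded Ω ∧ HyperbolicHardy.HasSmoothBoundary Ω ∧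
      HyperbolicHardy.ContainsParaboloidNearZero Ω ∧
      ∃ ε₀ : ℝ, 0 < ε₀ ∧ ∀ ε : ℝ, 0 < ε → ε < ε₀ →
        ∃ (v : HyperbolicHardy.E n → ℝ) (G : HyperbolicHardy.E n → HyperbolicHardy.E n),
          HyperbolicHardy.MemH10 Ω v G ∧
            ∫ x in Ω, ‖G x‖ ^ 2 <
              (((n : ℝ) + 1) ^ 2 / 4 - ε) * ∫ x in Ω, v x ^ 2 / ‖x‖ ^ 2) := by
  exact ⟨fun _ hΩ _ hε => HyperbolicHardy.hardy_memH10 hΩ hε,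
    HyperbolicHardy.exists_domain_hardy_fails hn⟩
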